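/- **Theorem (Effect of the overestimation policy).** Users $1,\dots,U$ have preference vectors $\theta_u\in\mathbb R^d$ with $\|\theta_u\|_2\le 1$ and are partitioned into clusters, with $\theta_u=\theta_v$ if and only if $u$ and $v$ are in the same cluster. There are at least two nonempty clusters, and $\gamma>0$ satisfies $\|\theta_u-\theta_v\|_2\ge\gamma$ whenever $u,v$ are in different clusters. *Data.* Let $\rho$ be a probability distribution on the closed unit ball of $\mathbb R^d$ such that the minimum eigenvalue $\lambda_a$ of $\mathbb E_{a\sim\rho}[aa^\top]$ is positive and, for some $\sigma>0$ and every unit vector $x$, the variable $(x^\top a)^2$, $a\sim\rho$, is sub-Gaussian around its mean with variance proxy $\sigma^2$. User $u$ has $N_u\ge 1$ logged samples $(a_u^i,r_u^i)_{i\le N_u}$, generated sequentially: at sample $i$ at most $S$ candidate actions are drawn independently from $\rho$, independently of the past of user $u$; a logging policy selects $a_u^i$ among them in an arbitrary (history-dependent, possibly randomized) way; and, conditionally on the past, the candidates and $a_u^i$, the reward $r_u^i$ has mean $\langle\theta_u,a_u^i\rangle$ and $1$-sub-Gaussian noise. Put $\tilde\lambda_a=\int_0^{\lambda_a}\bigl(1-e^{-(\lambda_a-x)^2/(2\sigma^2)}\bigr)^S\,dx$.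 *Statistics.* For parameters $\alpha\ge1$, $\lambda>0$, $\delta>0$ let $M_u=\lambda I+\sum_i a_u^i(a_u^i)^\top$, $b_u=\sum_i r_u^ia_u^i$, $\hat\theta_u=M_u^{-1}b_u$, $$\mathrm{CI}_u=\frac{\sqrt{d\log\bigl(1+\frac{N_u}{\lambda d}\bigr)+2\log\frac{2U}{\delta}}+\sqrt\lambda}{\sqrt{\tilde\lambda_aN_u/2}},$$ $$\Gamma(u,v)=\|\hat\theta_u-\hat\theta_v\|_2-\alpha(\mathrm{CI}_u+\mathrm{CI}_v),\qquad \tilde\Gamma(u,v)=\|\hat\theta_u-\hat\theta_v\|_2+\alpha(\mathrm{CI}_u+\mathrm{CI}_v),$$ and $M(u)=\{v\ne u:\Gamma(u,v)>0\}$. For a test user $u_{\rm test}$ let $\hat\gamma=\min_{v\in M(u_{\rm test})}\tilde\Gamma(u_{\rm test},v)$ if $M(u_{\rm test})\neq\emptyset$, and $\hat\gamma=0$ otherwise. Then, with probability at least $1-\tfrac32\delta$, the following holds: if $M(u_{\rm test})\ne\emptyset$, then $\hat\gamma\ge\gamma$. (For $\delta\ge 2/3$ the bound is trivial.) -/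

import Mathlib

open MeasureTheory ProbabilityTheory
open scoped NNReal RealInnerProductSpace

noncomputable section

namespace OffClusBand

/-- Actions and preference vectors: `ℝ^d` with the Euclidean norm. -/
abbrev Vec (d : ℕ) : Type := EuclideanSpace ℝ (Fin d)

/-- The second moment matrix `E_{a ∼ ρ}[a aᵀ]`. -/
def secondMoment {d : ℕ} (ρ : Measure (Vec d)) : Matrix (Fin d) (Fin d) ℝ :=
  Matrix.of fun i j => ∫ a, a i * a j ∂ρ

/-- Regularity of the action distribution `ρ`: it is carried by the closed unit ball, the minimum
eigenvalue `lamA` of `E[a aᵀ]` is positive, and for every unit vector `x` the random variable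
`(xᵀ a)²` is sub-Gaussian (around its mean) with variance proxy `σ²`. -/
structure RegularActionLaw {d : ℕ} (ρ : Measure (Vec d)) (lamA : ℝ) (σ : ℝ≥0) : Prop where
  prob : IsProbabilityMeasure ρ
  norm_le_one : ∀ᵐ a ∂ρ, ‖a‖ ≤ 1
  isLeast_eigenvalue : IsLeast (spectrum ℝ (secondMoment ρ)) lamA
  lamA_pos : 0 < lamA
  sigma_pos : 0 < σ
  subgaussian : ∀ x : Vec d, ‖x‖ = 1 →
    HasSubgaussianMGF (fun a => ⟪x, a⟫ ^ 2 - ∫ b, ⟪x, b⟫ ^ 2 ∂ρ) (σ ^ 2) ρ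

/-- The smoothed regularity parameter
`∫₀^{lamA} (1 - exp (-(lamA - x)² / (2 σ²)))^S dx`. -/
def smoothedRegularity (lamA : ℝ) (σ : ℝ≥0) (S : ℕ) : ℝ :=
  ∫ x in (0 : ℝ)..lamA, (1 - Real.exp (-(lamA - x) ^ 2 / (2 * (σ : ℝ) ^ 2))) ^ S

/-- A (random) offline dataset for `U` users: user `u` has `N u` samples, numbered `i < N u`; the
`i`-th sample consists of a finite list of candidate actions, the logged action and its reward.
Entries with `i ≥ N u` are never used. -/
structure OfflineData (Ω : Type*) (U d : ℕ) where
  /-- number of samples of each user -/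
  N : Fin U → ℕ
  /-- number of candidate actions at each sample -/
  numCand : Fin U → ℕ → ℕ
  /-- the candidate actions -/
  cand : (u : Fin U) → (i : ℕ) → Fin (numCand u i) → Ω → Vec d
  /-- the logged action -/
  action : Fin U → ℕ → Ω → Vec d
  /-- the logged reward -/
  reward : Fin U → ℕ → Ω → ℝ

/-- The noise of a reward: its deviation from the linear mean `⟨θ_u, a_u^i⟩`. -/
def noise {Ω : Type*} {U d : ℕ} (D : OfflineData Ω U d) (θ : Fin U → Vec d) (u : Fin U) (i : ℕ)
    (ω : Ω) : ℝ :=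
  D.reward u i ω - ⟪θ u, D.action u i ω⟫

/-- What is known just before the `i`-th reward of user `u` is drawn: the past, the `i`-th
candidates and the `i`-th action. -/
abbrev preReward {Ω : Type*} {mΩ : MeasurableSpace Ω} {U d : ℕ} (D : OfflineData Ω U d)
    (past : (u : Fin U) → Filtration ℕ mΩ) (u : Fin U) (i : ℕ) : MeasurableSpace Ω :=
  past u i ⊔ (⨆ j, MeasurableSpace.comap (D.cand u i j) inferInstance)
    ⊔ MeasurableSpace.comap (D.action u i) inferInstance

/-- The data-generating process. `past u i` is the information available before the `i`-th sample
of user `u`. At each sample at most `S` candidates are drawn independently from `ρ`, independently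
of the past; the logging policy selects one of them in an arbitrary (history dependent, possibly
randomized) way; and the reward has conditional mean `⟨θ_u, a_u^i⟩` with conditionally
`1`-sub-Gaussian noise. Nothing is required about the joint law of different users' data. -/
structure IsOffClusBand {Ω : Type*} {mΩ : MeasurableSpace Ω} {U d : ℕ} (μ : Measure Ω)
    (D : OfflineData Ω U d) (θ : Fin U → Vec d) (ρ : Measure (Vec d)) (S : ℕ)
    (past : (u : Fin U) → Filtration ℕ mΩ) : Prop where
  numCand_le : ∀ u, ∀ i < D.N u, D.numCand u i ≤ S
  measurable_cand : ∀ u, ∀ i < D.N u, ∀ j, Measurable[past u (i + 1)] (D.cand u i j)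
  measurable_action : ∀ u, ∀ i < D.N u, Measurable[past u (i + 1)] (D.action u i)
  measurable_reward : ∀ u, ∀ i < D.N u, Measurable[past u (i + 1)] (D.reward u i)
  cand_law : ∀ u, ∀ i < D.N u, ∀ j, μ.map (D.cand u i j) = ρ
  cand_iIndep : ∀ u, ∀ i < D.N u, iIndepFun (D.cand u i) μ
  cand_indep_past : ∀ u, ∀ i < D.N u,
    Indep (⨆ j, MeasurableSpace.comap (D.cand u i j) inferInstance) (past u i) μ
  action_mem : ∀ u, ∀ i < D.N u, ∀ᵐ ω ∂μ, ∃ j, D.action u i ω = D.cand u i j ω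
  reward_mean : ∀ u, ∀ i < D.N u,
    μ[D.reward u i | preReward D past u i] =ᵐ[μ] fun ω => ⟪θ u, D.action u i ω⟫
  integrable_exp_noise : ∀ u, ∀ i < D.N u, ∀ t : ℝ,
    Integrable (fun ω => Real.exp (t * noise D θ u i ω)) μ
  noise_subgaussian : ∀ u, ∀ i < D.N u, ∀ t : ℝ,
    μ[fun ω => Real.exp (t * noise D θ u i ω) | preReward D past u i]
      ≤ᵐ[μ] fun _ => Real.exp (t ^ 2 / 2)

section Statistics

variable {Ω : Type*} {U d : ℕ}

/-- `M_u = lam I + ∑_{i} a_u^i (a_u^i)ᵀ`. -/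
def gram (D : OfflineData Ω U d) (lam : ℝ) (u : Fin U) (ω : Ω) : Matrix (Fin d) (Fin d) ℝ :=
  lam • (1 : Matrix (Fin d) (Fin d) ℝ) +
    ∑ i ∈ Finset.range (D.N u), Matrix.vecMulVec (D.action u i ω).ofLp (D.action u i ω).ofLp

/-- `b_u = ∑_{i} r_u^i a_u^i`. -/
def moment (D : OfflineData Ω U d) (u : Fin U) (ω : Ω) : Vec d :=
  ∑ i ∈ Finset.range (D.N u), D.reward u i ω • D.action u i ω

/-- The ridge estimate `M_u⁻¹ b_u`. -/
def ridge (D : OfflineData Ω U d) (lam : ℝ) (u : Fin U) (ω : Ω) : Vec d :=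
  WithLp.toLp 2 ((gram D lam u ω)⁻¹.mulVec (moment D u ω).ofLp)

/-- The confidence width `CI_u`; `lamT` is the smoothed regularity parameter. -/
def confWidth (D : OfflineData Ω U d) (lam lamT δ : ℝ) (u : Fin U) : ℝ :=
  (√(d * Real.log (1 + D.N u / (lam * d)) + 2 * Real.log (2 * U / δ)) + √lam) /
    √(lamT * D.N u / 2)

/-- The lower statistic `Γ(u, v)`. -/
def lowerGap (D : OfflineData Ω U d) (lam lamT δ α : ℝ) (u v : Fin U) (ω : Ω) : ℝ :=
  ‖ridge D lam u ω - ridge D lam v ω‖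
    - α * (confWidth D lam lamT δ u + confWidth D lam lamT δ v)

/-- The upper statistic `Γ̃(u, v)`. -/
def upperGap (D : OfflineData Ω U d) (lam lamT δ α : ℝ) (u v : Fin U) (ω : Ω) : ℝ :=
  ‖ridge D lam u ω - ridge D lam v ω‖
    + α * (confWidth D lam lamT δ u + confWidth D lam lamT δ v)

open scoped Classical in
/-- `M(u) = {v ≠ u | Γ(u, v) > 0}`. -/
def certified (D : OfflineData Ω U d) (lam lamT δ α : ℝ) (u : Fin U) (ω : Ω) : Finset (Fin U) :=
  Finset.univ.filter fun v => v ≠ u ∧ 0 < lowerGap D lam lamT δ α u v ω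

open scoped Classical in
/-- The overestimation policy: the minimum of `Γ̃(u, ·)` over `M(u)`, and `0` if `M(u) = ∅`. -/
def gammaHatOver (D : OfflineData Ω U d) (lam lamT δ α : ℝ) (u : Fin U) (ω : Ω) : ℝ :=
  if h : (certified D lam lamT δ α u ω).Nonempty then
    (certified D lam lamT δ α u ω).inf' h fun v => upperGap D lam lamT δ α u v ω
  else 0

end Statistics

end OffClusBand

end

/-!
For a fixed direction `y` and noise `η_i`, consider the mean of `exp (∑ (⟪y, a_i⟫ η_i - ⟪y, a_i⟫²))`
over the samples of one user. Half of the compensator `⟪y, a_i⟫²` pays for the conditionally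
sub-Gaussian noise. The other half is kept for exploration: the logged action is one of at most `S`
independent draws, so by the definition of `λ̃` each sample multiplies the mean by at most
`exp (-(1 - exp (-‖y‖² / 2)) λ̃)`. Compensating this decay and mixing over `y` with a Gaussian
weight of precision `λ` gives a nonnegative random variable whose mean is at most the Gaussian
normalization. This replaces a separate concentration bound for the Gram matrix.

Suppose `CI_u ≤ 1` and the ridge estimate misses `θ_u` by more than `CI_u`. At the point `y` of norm
`CI_u` in the direction of the error, the normal equations make the mixture exponent at least
`(3 / 4) d log (1 + N_u / (λ d)) + log (2 U / δ)`. Jensen's inequality for the Gaussian weight of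
precision `λ + 2 N_u / d` centred at `y` then bounds the mixture below by `2 U / δ` times the
normalization, so by Markov's inequality this happens with probability at most `δ / (2 U)`.

Outside these events, if `Γ(u, v) > 0` and `Γ̃(u, v) < γ ≤ 2`, then
`Γ̃ - Γ = 2 α (CI_u + CI_v) < 2`, both widths are less than one, both confidence balls are valid,
and the triangle inequality gives `θ_u ≠ θ_v` and `‖θ_u - θ_v‖ ≤ Γ̃(u, v) < γ`, contradicting the
gap.
-/

noncomputable section

namespace OffClusBand

open Filter Topology
open scoped ENNReal
open Module (finrank finrank_pos)

section Conditional

variable {Ω T : Type*} {m mΩ : MeasurableSpace Ω} {μ : Measure Ω}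

theorem setLIntegral_comp_le_of_finite_range (hm : m ≤ mΩ) {F : T → Ω → ℝ≥0∞}
    (hF : ∀ t A, MeasurableSet[m] A → ∫⁻ ω in A, F t ω ∂μ ≤ μ A) {g : Ω → T}
    (hfin : (Set.range g).Finite) (hg : ∀ t, MeasurableSet[m] (g ⁻¹' {t}))
    {A : Set Ω} (hA : MeasurableSet[m] A) : ∫⁻ ω in A, F (g ω) ω ∂μ ≤ μ A := by
  have hfiber : ∀ t, MeasurableSet[m] (A ∩ g ⁻¹' {t}) := fun t => hA.inter (hg t)
  have hdisj : (hfin.toFinset : Set T).PairwiseDisjoint fun t => A ∩ g ⁻¹' {t} :=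
    fun s _ t _ hst => ((Set.disjoint_singleton.2 hst).preimage g).mono
      Set.inter_subset_right Set.inter_subset_right
  have hunion : A = ⋃ t ∈ hfin.toFinset, A ∩ g ⁻¹' {t} := by
    ext ω
    simp
  calc ∫⁻ ω in A, F (g ω) ω ∂μ
      = ∑ t ∈ hfin.toFinset, ∫⁻ ω in A ∩ g ⁻¹' {t}, F (g ω) ω ∂μ := by
        conv_lhs => rw [hunion]
        exact lintegral_biUnion_finset hdisj (fun t _ => hm _ (hfiber t)) _
    _ = ∑ t ∈ hfin.toFinset, ∫⁻ ω in A ∩ g ⁻¹' {t}, F t ω ∂μ :=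
        Finset.sum_congr rfl fun t _ => setLIntegral_congr_fun (hm _ (hfiber t))
          fun ω hω => by rw [show g ω = t from hω.2]
    _ ≤ ∑ t ∈ hfin.toFinset, μ (A ∩ g ⁻¹' {t}) :=
        Finset.sum_le_sum fun t _ => hF t _ (hfiber t)
    _ = μ A := by
        rw [← measure_biUnion_finset hdisj fun t _ => hm _ (hfiber t), ← hunion]

theorem setLIntegral_comp_le_of_continuous [TopologicalSpace T] (hm : m ≤ mΩ)
    {F : T → Ω → ℝ≥0∞} (hmeas : ∀ t, Measurable (F t)) (hcont : ∀ ω, Continuous fun t => F t ω)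
    (hF : ∀ t A, MeasurableSet[m] A → ∫⁻ ω in A, F t ω ∂μ ≤ μ A)
    {τ : Ω → T} (hτ : StronglyMeasurable[m] τ) {A : Set Ω} (hA : MeasurableSet[m] A) :
    ∫⁻ ω in A, F (τ ω) ω ∂μ ≤ μ A := by
  calc ∫⁻ ω in A, F (τ ω) ω ∂μ
      = ∫⁻ ω in A, liminf (fun k => F (hτ.approx k ω) ω) atTop ∂μ :=
        lintegral_congr fun ω =>
          (((hcont ω).tendsto _).comp (hτ.tendsto_approx ω)).liminf_eq.symm
    _ ≤ liminf (fun k => ∫⁻ ω in A, F (hτ.approx k ω) ω ∂μ) atTop :=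
        lintegral_liminf_le fun k => ((hτ.approx k).toLargerSpace hm).measurable_bind F hmeas
    _ ≤ μ A := (liminf_le_liminf (Eventually.of_forall fun k =>
        setLIntegral_comp_le_of_finite_range hm hF (@SimpleFunc.finite_range _ _ m (hτ.approx k))
          (@SimpleFunc.measurableSet_fiber _ _ m (hτ.approx k)) hA)).trans_eq
          (liminf_const (f := atTop) _)

theorem lintegral_mul_le_of_setLIntegral_le (hm : m ≤ mΩ) {f : Ω → ℝ≥0∞} (hf : AEMeasurable f μ)
    (hle : ∀ A, MeasurableSet[m] A → ∫⁻ ω in A, f ω ∂μ ≤ μ A)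
    {X : Ω → ℝ≥0∞} (hX : Measurable[m] X) :
    ∫⁻ ω, X ω * f ω ∂μ ≤ ∫⁻ ω, X ω ∂μ := by
  have htrim : (μ.withDensity f).trim hm ≤ μ.trim hm := Measure.le_iff.2 fun A hA => by
    rw [trim_measurableSet_eq hm hA, trim_measurableSet_eq hm hA, withDensity_apply _ (hm A hA)]
    exact hle A hA
  calc ∫⁻ ω, X ω * f ω ∂μ = ∫⁻ ω, X ω ∂(μ.withDensity f) := by
        simp only [lintegral_withDensity_eq_lintegral_mul₀ hf (hX.mono hm le_rfl).aemeasurable,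
          Pi.mul_apply, mul_comm]
    _ = ∫⁻ ω, X ω ∂((μ.withDensity f).trim hm) := (lintegral_trim hm hX).symm
    _ ≤ ∫⁻ ω, X ω ∂(μ.trim hm) := lintegral_mono' htrim le_rfl
    _ = ∫⁻ ω, X ω ∂μ := lintegral_trim hm hX

theorem setLIntegral_ofReal_le_of_condExp_le [IsFiniteMeasure μ] (hm : m ≤ mΩ) {f : Ω → ℝ}
    (hf : Integrable f μ) (hf0 : 0 ≤ f) {c : ℝ} (hc : μ[f | m] ≤ᵐ[μ] fun _ => c)
    {A : Set Ω} (hA : MeasurableSet[m] A) :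
    ∫⁻ ω in A, ENNReal.ofReal (f ω) ∂μ ≤ ENNReal.ofReal c * μ A := by
  have hreal : ∫ ω in A, f ω ∂μ ≤ μ.real A * c := by
    rw [← setIntegral_condExp hm hf hA, ← smul_eq_mul, ← setIntegral_const]
    exact integral_mono_ae integrable_condExp.integrableOn (integrable_const c)
      (ae_restrict_of_ae hc)
  rw [← ofReal_integral_eq_lintegral_ofReal hf.integrableOn (ae_of_all _ hf0)]
  refine (ENNReal.ofReal_le_ofReal hreal).trans_eq ?_
  rw [ENNReal.ofReal_mul measureReal_nonneg, ofReal_measureReal, mul_comm]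

theorem lintegral_mul_exp_sub_le_of_condExp_le [IsFiniteMeasure μ] (hm : m ≤ mΩ) {η : Ω → ℝ}
    (hη : Measurable η) (hint : ∀ t : ℝ, Integrable (fun ω => Real.exp (t * η ω)) μ)
    {ψ : ℝ → ℝ} (hψ : Continuous ψ)
    (hmgf : ∀ t : ℝ, μ[fun ω => Real.exp (t * η ω) | m] ≤ᵐ[μ] fun _ => Real.exp (ψ t))
    {τ : Ω → ℝ} (hτ : Measurable[m] τ) {X : Ω → ℝ≥0∞} (hX : Measurable[m] X) :
    ∫⁻ ω, X ω * ENNReal.ofReal (Real.exp (τ ω * η ω - ψ (τ ω))) ∂μ ≤ ∫⁻ ω, X ω ∂μ := by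
  have hfixed : ∀ t A, MeasurableSet[m] A →
      ∫⁻ ω in A, ENNReal.ofReal (Real.exp (t * η ω - ψ t)) ∂μ ≤ μ A := fun t A hA => by
    have hle := setLIntegral_ofReal_le_of_condExp_le hm (hint t)
      (fun ω => (Real.exp_pos _).le) (hmgf t) hA
    calc ∫⁻ ω in A, ENNReal.ofReal (Real.exp (t * η ω - ψ t)) ∂μ
        = ENNReal.ofReal (Real.exp (-ψ t)) *
            ∫⁻ ω in A, ENNReal.ofReal (Real.exp (t * η ω)) ∂μ := by
          rw [← lintegral_const_mul _ (by fun_prop)]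
          refine lintegral_congr fun ω => ?_
          rw [← ENNReal.ofReal_mul (Real.exp_pos _).le, ← Real.exp_add, neg_add_eq_sub]
      _ ≤ ENNReal.ofReal (Real.exp (-ψ t)) * (ENNReal.ofReal (Real.exp (ψ t)) * μ A) := by gcongr
      _ = μ A := by
          rw [← mul_assoc, ← ENNReal.ofReal_mul (Real.exp_pos _).le, ← Real.exp_add]
          simp
  have hτ' : Measurable τ := hτ.mono hm le_rfl
  exact lintegral_mul_le_of_setLIntegral_le hm (by fun_prop)
    (fun A hA => setLIntegral_comp_le_of_continuous hm
      (F := fun t ω => ENNReal.ofReal (Real.exp (t * η ω - ψ t)))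
      (fun t => by fun_prop) (fun ω => ENNReal.continuous_ofReal.comp (by fun_prop)) hfixed
      hτ.stronglyMeasurable hA) hX

end Conditional

section ActionLaw

theorem isHermitian_mul_dotProduct_le {n : Type*} [Fintype n] [DecidableEq n] {A : Matrix n n ℝ}
    (hA : A.IsHermitian) {c : ℝ} (hc : c ∈ lowerBounds (spectrum ℝ A)) (x : n → ℝ) :
    c * (x ⬝ᵥ x) ≤ x ⬝ᵥ A.mulVec x := by
  have hpsd : (A - algebraMap ℝ (Matrix n n ℝ) c).PosSemidef := by
    refine Matrix.posSemidef_iff_isHermitian_and_spectrum_nonneg.2 ⟨hA.sub ?_, fun t ht => ?_⟩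
    · rw [Algebra.algebraMap_eq_smul_one]
      exact Matrix.isHermitian_one.smul (IsSelfAdjoint.all c)
    · rw [← spectrum.sub_singleton_eq] at ht
      obtain ⟨s, hs, _, rfl, rfl⟩ := ht
      exact sub_nonneg.2 (hc hs)
  have h := hpsd.dotProduct_mulVec_nonneg x
  simp only [star_trivial, Matrix.sub_mulVec, dotProduct_sub, Algebra.algebraMap_eq_smul_one,
    Matrix.smul_mulVec, Matrix.one_mulVec, dotProduct_smul, smul_eq_mul] at h
  exact sub_nonneg.1 h

variable {d : ℕ} {ρ : Measure (Vec d)}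

theorem isHermitian_secondMoment : (secondMoment ρ).IsHermitian := by
  ext i j
  simp [secondMoment, mul_comm]

theorem integral_inner_sq_eq (hint : ∀ i j, Integrable (fun a : Vec d => a i * a j) ρ)
    (x : Vec d) :
    ∫ a, ⟪x, a⟫ ^ 2 ∂ρ = x.ofLp ⬝ᵥ (secondMoment ρ).mulVec x.ofLp := by
  have hexpand : ∀ a : Vec d, ⟪x, a⟫ ^ 2 = ∑ i, ∑ j, x i * x j * (a i * a j) := fun a => by
    rw [PiLp.inner_apply, sq, Finset.sum_mul_sum]
    refine Finset.sum_congr rfl fun i _ => Finset.sum_congr rfl fun j _ => ?_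
    simp only [RCLike.inner_apply, conj_trivial]
    ring
  simp only [hexpand, dotProduct, Matrix.mulVec, secondMoment, Matrix.of_apply, Finset.mul_sum]
  rw [integral_finsetSum _ fun i _ => integrable_finsetSum _ fun j _ => (hint i j).const_mul _]
  refine Finset.sum_congr rfl fun i _ => ?_
  rw [integral_finsetSum _ fun j _ => (hint i j).const_mul _]
  refine Finset.sum_congr rfl fun j _ => ?_
  rw [integral_const_mul]
  ring

theorem one_sub_exp_neg_sq_div_mem_Icc (t s : ℝ) :
    1 - Real.exp (-t ^ 2 / (2 * s ^ 2)) ∈ Set.Icc (0 : ℝ) 1 := by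
  refine ⟨sub_nonneg.2 (Real.exp_le_one_iff.2 ?_), sub_le_self _ (Real.exp_pos _).le⟩
  rw [neg_div]
  exact neg_nonpos.2 (by positivity)

theorem continuous_smoothedRegularity_integrand (lamA : ℝ) (σ : ℝ≥0) (S : ℕ) :
    Continuous fun x : ℝ => (1 - Real.exp (-(lamA - x) ^ 2 / (2 * (σ : ℝ) ^ 2))) ^ S := by
  fun_prop

theorem smoothedRegularity_le {lamA : ℝ} (hlamA : 0 ≤ lamA) (σ : ℝ≥0) (S : ℕ) :
    smoothedRegularity lamA σ S ≤ lamA := by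
  calc smoothedRegularity lamA σ S ≤ ∫ _ in (0 : ℝ)..lamA, (1 : ℝ) :=
        intervalIntegral.integral_mono_on hlamA
          ((continuous_smoothedRegularity_integrand lamA σ S).intervalIntegrable _ _)
          intervalIntegrable_const fun x _ =>
            pow_le_one₀ (one_sub_exp_neg_sq_div_mem_Icc _ _).1
              (one_sub_exp_neg_sq_div_mem_Icc _ _).2
    _ = lamA := by simp

theorem smoothedRegularity_pos {lamA : ℝ} (hlamA : 0 < lamA) {σ : ℝ≥0} (hσ : 0 < σ) (S : ℕ) :
    0 < smoothedRegularity lamA σ S := by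
  refine intervalIntegral.intervalIntegral_pos_of_pos_on
    ((continuous_smoothedRegularity_integrand lamA σ S).intervalIntegrable _ _)
    (fun x hx => ?_) hlamA
  have hgap : 0 < lamA - x := sub_pos.2 hx.2
  refine pow_pos (sub_pos.2 (Real.exp_lt_one_iff.2 ?_)) _
  rw [neg_div]
  exact neg_neg_of_pos (by positivity)

namespace RegularActionLaw

variable {lamA : ℝ} {σ : ℝ≥0}

theorem dim_pos (hρ : RegularActionLaw ρ lamA σ) : 0 < d := by
  by_contra hd
  obtain rfl : d = 0 := by lia
  have hmem := hρ.isLeast_eigenvalue.1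
  rw [spectrum.of_subsingleton] at hmem
  exact hmem

theorem integrable_apply_mul (hρ : RegularActionLaw ρ lamA σ) (i j : Fin d) :
    Integrable (fun a : Vec d => a i * a j) ρ := by
  have := hρ.prob
  refine Integrable.of_bound (C := 1) (by fun_prop) ?_
  filter_upwards [hρ.norm_le_one] with a ha
  rw [norm_mul]
  exact mul_le_one₀ ((PiLp.norm_apply_le a i).trans ha) (norm_nonneg _)
    ((PiLp.norm_apply_le a j).trans ha)

theorem le_integral_inner_sq (hρ : RegularActionLaw ρ lamA σ) (x : Vec d) :
    lamA * ‖x‖ ^ 2 ≤ ∫ a, ⟪x, a⟫ ^ 2 ∂ρ := by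
  have hnorm : ‖x‖ ^ 2 = x.ofLp ⬝ᵥ x.ofLp := by
    rw [EuclideanSpace.real_norm_sq_eq]
    simp only [dotProduct, sq]
  rw [integral_inner_sq_eq hρ.integrable_apply_mul, hnorm]
  exact isHermitian_mul_dotProduct_le isHermitian_secondMoment hρ.isLeast_eigenvalue.2 _

theorem dim_mul_le_one (hρ : RegularActionLaw ρ lamA σ) : d * lamA ≤ 1 := by
  have := hρ.prob
  have hcoord : ∀ i : Fin d, lamA ≤ ∫ a, a i * a i ∂ρ := fun i => by
    simpa [EuclideanSpace.inner_single_left, sq] using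
      hρ.le_integral_inner_sq (EuclideanSpace.single i 1)
  calc d * lamA = ∑ _i : Fin d, lamA := by simp
    _ ≤ ∑ i : Fin d, ∫ a, a i * a i ∂ρ := Finset.sum_le_sum fun i _ => hcoord i
    _ = ∫ a, ‖a‖ ^ 2 ∂ρ := by
        rw [← integral_finsetSum _ fun i _ => hρ.integrable_apply_mul i i]
        simp only [← sq, EuclideanSpace.real_norm_sq_eq]
    _ ≤ ∫ _, (1 : ℝ) ∂ρ :=
        integral_mono_of_nonneg (ae_of_all _ fun _ => sq_nonneg _) (integrable_const _)
          (hρ.norm_le_one.mono fun a ha => pow_le_one₀ (norm_nonneg a) ha)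
    _ = 1 := by simp

theorem one_sub_exp_le_measureReal (hρ : RegularActionLaw ρ lamA σ) {x : Vec d} (hx : ‖x‖ = 1)
    {z : ℝ} (hz : z ≤ lamA) :
    1 - Real.exp (-(lamA - z) ^ 2 / (2 * (σ : ℝ) ^ 2)) ≤ ρ.real {a | z < ⟪x, a⟫ ^ 2} := by
  have := hρ.prob
  set c := ∫ b, ⟪x, b⟫ ^ 2 ∂ρ
  have hmean : lamA ≤ c := by simpa [hx] using hρ.le_integral_inner_sq x
  have htail := (hρ.subgaussian x hx).neg.measure_ge_le (sub_nonneg.2 (hz.trans hmean))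
  have hcompl : {a : Vec d | z < ⟪x, a⟫ ^ 2} =
      {a | c - z ≤ (-fun a => ⟪x, a⟫ ^ 2 - c) a}ᶜ := by
    ext a
    simp only [Set.mem_ofPred_eq, Set.mem_compl_iff, Pi.neg_apply, not_le]
    constructor <;> intro h <;> linarith
  have hmeas : MeasurableSet {a : Vec d | c - z ≤ (-fun a => ⟪x, a⟫ ^ 2 - c) a} :=
    measurableSet_le measurable_const (by simp only [Pi.neg_def]; fun_prop)
  rw [hcompl, probReal_compl_eq_one_sub hmeas]
  refine sub_le_sub_left (htail.trans (Real.exp_le_exp.2 ?_)) _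
  have := sub_nonneg.2 hz
  rw [NNReal.coe_pow]
  gcongr

end RegularActionLaw

end ActionLaw

section Candidates

section MinSq

variable {Ω ι E : Type*} [Fintype ι] [Nonempty ι] [NormedAddCommGroup E] [InnerProductSpace ℝ E]

/-- The smallest squared component in direction `x` among finitely many candidate actions; whatever
the logging policy does, the logged action has at least this squared component. -/
def minSq (c : ι → Ω → E) (x : E) (ω : Ω) : ℝ :=
  Finset.univ.inf' Finset.univ_nonempty fun j => ⟪x, c j ω⟫ ^ 2

variable {c : ι → Ω → E}

theorem minSq_nonneg (x : E) (ω : Ω) : 0 ≤ minSq c x ω :=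
  Finset.le_inf' _ _ fun _ _ => sq_nonneg _

theorem minSq_le (x : E) (ω : Ω) (j : ι) : minSq c x ω ≤ ⟪x, c j ω⟫ ^ 2 :=
  Finset.inf'_le _ (Finset.mem_univ j)

theorem minSq_smul (t : ℝ) (x : E) (ω : Ω) : minSq c (t • x) ω = t ^ 2 * minSq c x ω := by
  have hmono : Monotone fun z : ℝ => t ^ 2 * z := fun _ _ h =>
    mul_le_mul_of_nonneg_left h (sq_nonneg t)
  simp only [minSq, real_inner_smul_left, mul_pow]
  exact (map_finset_inf' (OrderHom.mk _ hmono) _ _).symm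

variable [MeasurableSpace E] [OpensMeasurableSpace E]

theorem measurable_minSq {m : MeasurableSpace Ω} (hc : ∀ j, Measurable[m] (c j)) (x : E) :
    Measurable[m] (minSq c x) := by
  have heq : minSq c x = Finset.univ.inf' Finset.univ_nonempty fun j ω => ⟪x, c j ω⟫ ^ 2 := by
    ext ω
    simp only [minSq, Finset.inf'_apply]
  have hinner : Measurable fun e : E => ⟪x, e⟫ ^ 2 := by fun_prop
  rw [heq]
  exact Finset.inf'_induction (p := fun f => Measurable[m] f) Finset.univ_nonempty _
    (fun f hf g hg => hf.inf hg) fun j _ => hinner.comp (hc j)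

end MinSq

theorem exp_neg_mul_le_one_sub {s z : ℝ} (hz0 : 0 ≤ z) (hz1 : z ≤ 1) :
    Real.exp (-(s * z)) ≤ 1 - (1 - Real.exp (-s)) * z := by
  have hconv := convexOn_exp.2 (Set.mem_univ 0) (Set.mem_univ (-s)) (sub_nonneg.2 hz1) hz0
    (sub_add_cancel 1 z)
  simp only [smul_eq_mul, mul_zero, zero_add, Real.exp_zero, mul_one] at hconv
  rw [show -(s * z) = z * -s by ring]
  linarith

variable {Ω ι : Type*} {mΩ : MeasurableSpace Ω} {μ : Measure Ω} [Fintype ι] [Nonempty ι]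
  {d S : ℕ} {ρ : Measure (Vec d)} {lamA : ℝ} {σ : ℝ≥0} {c : ι → Ω → Vec d}

namespace RegularActionLaw

theorem ae_minSq_le_one (hρ : RegularActionLaw ρ lamA σ) (hc : ∀ j, Measurable (c j))
    (hlaw : ∀ j, μ.map (c j) = ρ) {x : Vec d} (hx : ‖x‖ = 1) : ∀ᵐ ω ∂μ, minSq c x ω ≤ 1 := by
  obtain ⟨j⟩ := ‹Nonempty ι›
  have hball := hρ.norm_le_one
  rw [← hlaw j] at hball
  filter_upwards [ae_of_ae_map (hc j).aemeasurable hball] with ω hω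
  refine (minSq_le x ω j).trans ((sq_le_one_iff_abs_le_one _).2 ?_)
  exact (abs_real_inner_le_norm _ _).trans (by rwa [hx, one_mul])

theorem integrable_minSq [IsFiniteMeasure μ] (hρ : RegularActionLaw ρ lamA σ)
    (hc : ∀ j, Measurable (c j)) (hlaw : ∀ j, μ.map (c j) = ρ) {x : Vec d} (hx : ‖x‖ = 1) :
    Integrable (minSq c x) μ := by
  refine Integrable.of_bound (C := 1) (measurable_minSq hc x).aestronglyMeasurable ?_
  filter_upwards [hρ.ae_minSq_le_one hc hlaw hx] with ω hω
  rwa [Real.norm_of_nonneg (minSq_nonneg x ω)]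

theorem one_sub_exp_pow_le_measure (hρ : RegularActionLaw ρ lamA σ) (hS : Fintype.card ι ≤ S)
    (hc : ∀ j, Measurable (c j)) (hlaw : ∀ j, μ.map (c j) = ρ) (hind : iIndepFun c μ)
    {x : Vec d} (hx : ‖x‖ = 1) {z : ℝ} (hz : z ≤ lamA) :
    ENNReal.ofReal ((1 - Real.exp (-(lamA - z) ^ 2 / (2 * (σ : ℝ) ^ 2))) ^ S)
      ≤ μ {ω | z < minSq c x ω} := by
  have := hρ.prob
  obtain ⟨hp0, hp1⟩ := one_sub_exp_neg_sq_div_mem_Icc (lamA - z) σ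
  set p := 1 - Real.exp (-(lamA - z) ^ 2 / (2 * (σ : ℝ) ^ 2))
  have hA : MeasurableSet {a : Vec d | z < ⟪x, a⟫ ^ 2} :=
    measurableSet_lt measurable_const (by fun_prop)
  have hinter : {ω | z < minSq c x ω} = ⋂ j ∈ Finset.univ, c j ⁻¹' {a | z < ⟪x, a⟫ ^ 2} := by
    ext ω
    simp [minSq, Finset.lt_inf'_iff]
  calc ENNReal.ofReal (p ^ S) ≤ ENNReal.ofReal (p ^ Fintype.card ι) :=
        ENNReal.ofReal_le_ofReal (pow_le_pow_of_le_one hp0 hp1 hS)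
    _ = ENNReal.ofReal p ^ Fintype.card ι := ENNReal.ofReal_pow hp0 _
    _ ≤ ρ {a | z < ⟪x, a⟫ ^ 2} ^ Fintype.card ι := by
        gcongr
        exact ENNReal.ofReal_le_of_le_toReal (hρ.one_sub_exp_le_measureReal hx hz)
    _ = ∏ j, μ (c j ⁻¹' {a | z < ⟪x, a⟫ ^ 2}) := by
        simp only [← Measure.map_apply (hc _) hA, hlaw, Finset.prod_const, Finset.card_univ]
    _ = μ {ω | z < minSq c x ω} := by
        rw [hinter, hind.measure_inter_preimage_eq_mul Finset.univ fun _ _ => hA]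

theorem smoothedRegularity_le_integral_minSq [IsFiniteMeasure μ]
    (hρ : RegularActionLaw ρ lamA σ) (hS : Fintype.card ι ≤ S)
    (hc : ∀ j, Measurable (c j)) (hlaw : ∀ j, μ.map (c j) = ρ) (hind : iIndepFun c μ)
    {x : Vec d} (hx : ‖x‖ = 1) : smoothedRegularity lamA σ S ≤ ∫ ω, minSq c x ω ∂μ := by
  have hnonneg : ∀ᵐ ω ∂μ, 0 ≤ minSq c x ω := ae_of_all _ (minSq_nonneg x)
  refine (ENNReal.ofReal_le_ofReal_iff (integral_nonneg (minSq_nonneg x))).1 ?_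
  rw [ofReal_integral_eq_lintegral_ofReal (hρ.integrable_minSq hc hlaw hx) hnonneg,
    lintegral_eq_lintegral_meas_lt μ hnonneg (measurable_minSq hc x).aemeasurable,
    smoothedRegularity, intervalIntegral.integral_of_le hρ.lamA_pos.le,
    ofReal_integral_eq_lintegral_ofReal
      ((continuous_smoothedRegularity_integrand lamA σ S).integrableOn_Ioc)
      (ae_of_all _ fun z => pow_nonneg (one_sub_exp_neg_sq_div_mem_Icc _ _).1 _)]
  calc _ ≤ ∫⁻ z in Set.Ioc 0 lamA, μ {ω | z < minSq c x ω} :=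
        setLIntegral_mono' measurableSet_Ioc fun z hz =>
          hρ.one_sub_exp_pow_le_measure hS hc hlaw hind hx hz.2
    _ ≤ _ := lintegral_mono_set Set.Ioc_subset_Ioi_self

theorem lintegral_exp_neg_mul_minSq_le [IsProbabilityMeasure μ]
    (hρ : RegularActionLaw ρ lamA σ) (hS : Fintype.card ι ≤ S)
    (hc : ∀ j, Measurable (c j)) (hlaw : ∀ j, μ.map (c j) = ρ) (hind : iIndepFun c μ)
    {x : Vec d} (hx : ‖x‖ = 1) {s : ℝ} (hs : 0 ≤ s) :
    ∫⁻ ω, ENNReal.ofReal (Real.exp (-(s * minSq c x ω))) ∂μ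
      ≤ ENNReal.ofReal (Real.exp (-((1 - Real.exp (-s)) * smoothedRegularity lamA σ S))) := by
  set κ := 1 - Real.exp (-s)
  have hκ : 0 ≤ κ := by simpa [κ] using hs
  have hint := (hρ.integrable_minSq hc hlaw hx).const_mul κ
  have hchord : ∀ᵐ ω ∂μ, Real.exp (-(s * minSq c x ω)) ≤ 1 - κ * minSq c x ω := by
    filter_upwards [hρ.ae_minSq_le_one hc hlaw hx] with ω hω
    exact exp_neg_mul_le_one_sub (minSq_nonneg x ω) hω
  calc ∫⁻ ω, ENNReal.ofReal (Real.exp (-(s * minSq c x ω))) ∂μ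
      ≤ ∫⁻ ω, ENNReal.ofReal (1 - κ * minSq c x ω) ∂μ :=
        lintegral_mono_ae (hchord.mono fun ω h => ENNReal.ofReal_le_ofReal h)
    _ = ENNReal.ofReal (∫ ω, (1 - κ * minSq c x ω) ∂μ) :=
        (ofReal_integral_eq_lintegral_ofReal ((integrable_const _).sub hint)
          (hchord.mono fun ω h => (Real.exp_pos _).le.trans h)).symm
    _ = ENNReal.ofReal (1 - κ * ∫ ω, minSq c x ω ∂μ) := by
        rw [integral_sub (integrable_const _) hint, integral_const_mul]
        simp
    _ ≤ ENNReal.ofReal (1 - κ * smoothedRegularity lamA σ S) := by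
        gcongr
        exact hρ.smoothedRegularity_le_integral_minSq hS hc hlaw hind hx
    _ ≤ ENNReal.ofReal (Real.exp (-(κ * smoothedRegularity lamA σ S))) :=
        ENNReal.ofReal_le_ofReal (Real.one_sub_le_exp_neg _)

theorem lintegral_exp_neg_minSq_div_two_le [IsProbabilityMeasure μ]
    (hρ : RegularActionLaw ρ lamA σ) (hS : Fintype.card ι ≤ S)
    (hc : ∀ j, Measurable (c j)) (hlaw : ∀ j, μ.map (c j) = ρ) (hind : iIndepFun c μ)
    (y : Vec d) :
    ∫⁻ ω, ENNReal.ofReal (Real.exp (-(minSq c y ω / 2))) ∂μ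
      ≤ ENNReal.ofReal
          (Real.exp (-((1 - Real.exp (-(‖y‖ ^ 2 / 2))) * smoothedRegularity lamA σ S))) := by
  have : Nonempty (Fin d) := ⟨⟨0, hρ.dim_pos⟩⟩
  obtain ⟨x, hx, hxy⟩ : ∃ x : Vec d, ‖x‖ = 1 ∧ ‖y‖ • x = y := by
    rcases eq_or_ne y 0 with rfl | hy
    · obtain ⟨x, hx⟩ := exists_norm_eq (Vec d) zero_le_one
      exact ⟨x, hx, by simp⟩
    · exact ⟨‖y‖⁻¹ • y, norm_smul_inv_norm (𝕜 := ℝ) hy, smul_inv_smul₀ (norm_ne_zero_iff.2 hy) y⟩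
  have hscale : ∀ ω, minSq c y ω / 2 = ‖y‖ ^ 2 / 2 * minSq c x ω := fun ω => by
    conv_lhs => rw [← hxy, minSq_smul]
    ring
  simp only [hscale]
  exact hρ.lintegral_exp_neg_mul_minSq_le hS hc hlaw hind hx (by positivity)

end RegularActionLaw

end Candidates

section Gaussian

theorem ofReal_integral_le_lintegral {α : Type*} {mα : MeasurableSpace α} {ν : Measure α}
    {f : α → ℝ} (hf : Integrable f ν) :
    ENNReal.ofReal (∫ x, f x ∂ν) ≤ ∫⁻ x, ENNReal.ofReal (f x) ∂ν := by
  rw [integral_eq_lintegral_pos_part_sub_lintegral_neg_part hf]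
  exact (ENNReal.ofReal_le_ofReal (sub_le_self _ ENNReal.toReal_nonneg)).trans
    ENNReal.ofReal_toReal_le

theorem ofReal_integral_le_lintegral_exp_mul {α : Type*} {mα : MeasurableSpace α} {ν : Measure α}
    {H q : α → ℝ} (hq0 : 0 ≤ q) (hq : Integrable q ν) (hHq : Integrable (fun x => H x * q x) ν)
    (hH : 0 ≤ ∫ x, H x * q x ∂ν) :
    ENNReal.ofReal (∫ x, q x ∂ν) ≤ ∫⁻ x, ENNReal.ofReal (Real.exp (H x) * q x) ∂ν := by
  calc ENNReal.ofReal (∫ x, q x ∂ν) ≤ ENNReal.ofReal (∫ x, (H x * q x + q x) ∂ν) := by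
        rw [integral_add hHq hq]
        gcongr
        exact le_add_of_nonneg_left hH
    _ ≤ ∫⁻ x, ENNReal.ofReal (H x * q x + q x) ∂ν := ofReal_integral_le_lintegral (hHq.add hq)
    _ ≤ ∫⁻ x, ENNReal.ofReal (Real.exp (H x) * q x) ∂ν := by
        refine lintegral_mono fun x => ENNReal.ofReal_le_ofReal ?_
        rw [← add_one_mul]
        exact mul_le_mul_of_nonneg_right (Real.add_one_le_exp _) (hq0 x)

variable {E : Type*} [NormedAddCommGroup E]

/-- The unnormalized centred Gaussian density of precision `P`. -/
def gaussianWeight (P : ℝ) (w : E) : ℝ := Real.exp (-(P / 2) * ‖w‖ ^ 2)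

theorem gaussianWeight_nonneg (P : ℝ) (w : E) : 0 ≤ gaussianWeight P w := (Real.exp_pos _).le

theorem gaussianWeight_one (w : E) : gaussianWeight 1 w = Real.exp (-(‖w‖ ^ 2 / 2)) := by
  rw [gaussianWeight]
  congr 1
  ring

theorem gaussianWeight_le_one {P : ℝ} (hP : 0 ≤ P) (w : E) : gaussianWeight P w ≤ 1 := by
  rw [gaussianWeight, Real.exp_le_one_iff, neg_mul]
  exact neg_nonpos.2 (by positivity)

theorem continuous_gaussianWeight (P : ℝ) : Continuous (gaussianWeight P : E → ℝ) := by
  unfold gaussianWeight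
  fun_prop

theorem norm_sq_le_mul_gaussianWeight_neg {P : ℝ} (hP : 0 < P) (w : E) :
    ‖w‖ ^ 2 ≤ 2 / P * gaussianWeight (-P) w := by
  have h := Real.add_one_le_exp (-(-P / 2) * ‖w‖ ^ 2)
  rw [gaussianWeight, div_mul_eq_mul_div, le_div_iff₀ hP]
  linarith

variable [InnerProductSpace ℝ E]

theorem gaussianWeight_add_mul_gaussianWeight {P Q : ℝ} (hPQ : P + Q ≠ 0) (y w : E) :
    gaussianWeight Q (y + w) * gaussianWeight P w =
      gaussianWeight (P * Q / (P + Q)) y * gaussianWeight (P + Q) (w + (Q / (P + Q)) • y) := by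
  simp only [gaussianWeight, ← Real.exp_add, norm_add_sq_real, norm_smul, Real.norm_eq_abs,
    mul_pow, sq_abs, real_inner_smul_right, real_inner_comm w y]
  congr 1
  field_simp
  ring

variable [MeasurableSpace E] [BorelSpace E] [FiniteDimensional ℝ E]

theorem integral_gaussianWeight {P : ℝ} (hP : 0 < P) :
    ∫ w : E, gaussianWeight P w = (2 * Real.pi / P) ^ (finrank ℝ E / 2 : ℝ) := by
  simp only [gaussianWeight]
  rw [GaussianFourier.integral_rexp_neg_mul_sq_norm (half_pos hP), div_div_eq_mul_div, mul_comm]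

theorem integrable_gaussianWeight {P : ℝ} (hP : 0 < P) :
    Integrable (gaussianWeight P : E → ℝ) := by
  refine .of_integral_ne_zero ?_
  rw [integral_gaussianWeight hP]
  positivity

theorem integrable_norm_sq_mul_gaussianWeight {P : ℝ} (hP : 0 < P) :
    Integrable fun w : E => ‖w‖ ^ 2 * gaussianWeight P w := by
  have hcont := continuous_gaussianWeight (E := E) P
  refine ((integrable_gaussianWeight (E := E) (half_pos hP)).const_mul (2 / (P / 2))).mono'
    (by fun_prop) (ae_of_all _ fun w => ?_)
  rw [Real.norm_of_nonneg (mul_nonneg (sq_nonneg _) (gaussianWeight_nonneg P w))]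
  refine (mul_le_mul_of_nonneg_right (norm_sq_le_mul_gaussianWeight_neg (half_pos hP) w)
    (gaussianWeight_nonneg P w)).trans_eq ?_
  rw [mul_assoc, gaussianWeight, gaussianWeight, ← Real.exp_add, gaussianWeight]
  congr 2
  ring

theorem integrable_inner_sq_mul {q : E → ℝ} (hq : Integrable fun w => ‖w‖ ^ 2 * q w) (a : E) :
    Integrable fun w => ⟪a, w⟫ ^ 2 * q w := by
  have heq : ∀ w, ⟪a, w⟫ ^ 2 * q w = ⟪a, w⟫ ^ 2 / ‖w‖ ^ 2 * (‖w‖ ^ 2 * q w) := fun w => by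
    rcases eq_or_ne w 0 with rfl | hw
    · simp
    · have := norm_ne_zero_iff.2 hw
      field_simp
  simp only [heq]
  have hmeas : Measurable fun w => ⟪a, w⟫ ^ 2 / ‖w‖ ^ 2 := by fun_prop
  refine hq.bdd_mul (c := ‖a‖ ^ 2) hmeas.aestronglyMeasurable (ae_of_all _ fun w => ?_)
  rw [Real.norm_of_nonneg (by positivity)]
  refine div_le_of_le_mul₀ (sq_nonneg _) (sq_nonneg _) ?_
  rw [← mul_pow, ← sq_abs]
  exact pow_le_pow_left₀ (abs_nonneg _) (abs_real_inner_le_norm a w) 2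

theorem integrable_inner_mul {q : E → ℝ} (hq : Integrable q)
    (hq2 : Integrable fun w => ‖w‖ ^ 2 * q w) (a : E) : Integrable fun w => ⟪a, w⟫ * q w := by
  refine (hq.norm.add (integrable_inner_sq_mul hq2 a).norm).mono'
    (.mul (by fun_prop) hq.aestronglyMeasurable) (ae_of_all _ fun w => ?_)
  simp only [Pi.add_apply, norm_mul, ← one_add_mul, norm_pow]
  gcongr
  nlinarith [sq_nonneg (‖⟪a, w⟫‖ - 1)]

theorem integral_inner_mul_radial (φ : ℝ → ℝ) (a : E) : ∫ w : E, ⟪a, w⟫ * φ ‖w‖ = 0 := by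
  have h := integral_neg_eq_self (fun w : E => ⟪a, w⟫ * φ ‖w‖) volume
  simp only [inner_neg_right, norm_neg, neg_mul, integral_neg] at h
  linarith

theorem integral_inner_sq_mul_radial_congr (φ : ℝ → ℝ) {x y : E} (hxy : ‖x‖ = ‖y‖) :
    ∫ w : E, ⟪x, w⟫ ^ 2 * φ ‖w‖ = ∫ w : E, ⟪y, w⟫ ^ 2 * φ ‖w‖ := by
  set R := (ℝ ∙ (x - y))ᗮ.reflection
  have hR : R x = y := Submodule.reflection_sub hxy
  rw [← R.measurePreserving.integral_comp R.toHomeomorph.measurableEmbedding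
    (fun w : E => ⟪y, w⟫ ^ 2 * φ ‖w‖)]
  simp only [LinearIsometryEquiv.norm_map, ← hR, LinearIsometryEquiv.inner_map_map]

theorem finrank_mul_integral_inner_sq_mul_radial (φ : ℝ → ℝ)
    (hφ : Integrable fun w : E => ‖w‖ ^ 2 * φ ‖w‖) (a : E) :
    finrank ℝ E * ∫ w : E, ⟪a, w⟫ ^ 2 * φ ‖w‖ = ‖a‖ ^ 2 * ∫ w : E, ‖w‖ ^ 2 * φ ‖w‖ := by
  set b := stdOrthonormalBasis ℝ E
  have hrotate : ∀ i, ∫ w : E, ⟪a, w⟫ ^ 2 * φ ‖w‖ =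
      ‖a‖ ^ 2 * ∫ w : E, ⟪b i, w⟫ ^ 2 * φ ‖w‖ := fun i => by
    rw [integral_inner_sq_mul_radial_congr φ (y := ‖a‖ • b i) (by simp [norm_smul]),
      ← integral_const_mul]
    simp only [real_inner_smul_left, mul_pow, mul_assoc]
  calc finrank ℝ E * ∫ w : E, ⟪a, w⟫ ^ 2 * φ ‖w‖
      = ∑ i, ‖a‖ ^ 2 * ∫ w : E, ⟪b i, w⟫ ^ 2 * φ ‖w‖ := by
        simp only [← hrotate, Finset.sum_const, Finset.card_univ, Fintype.card_fin, nsmul_eq_mul]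
    _ = ‖a‖ ^ 2 * ∫ w : E, ∑ i, ⟪b i, w⟫ ^ 2 * φ ‖w‖ := by
        rw [← Finset.mul_sum, integral_finsetSum _ fun i _ => integrable_inner_sq_mul hφ (b i)]
    _ = ‖a‖ ^ 2 * ∫ w : E, ‖w‖ ^ 2 * φ ‖w‖ := by
        simp only [← Finset.sum_mul, b.sum_sq_inner_right]

variable {P : ℝ}

theorem integrable_norm_sq_div_sub_inner_sq_mul_gaussianWeight (hP : 0 < P) (c : ℝ) (a : E) :
    Integrable fun w : E => (‖w‖ ^ 2 / c - ⟪a, w⟫ ^ 2) * gaussianWeight P w := by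
  have hq := integrable_norm_sq_mul_gaussianWeight (E := E) hP
  simp only [sub_mul, div_mul_eq_mul_div]
  exact (hq.div_const c).sub (integrable_inner_sq_mul hq a)

theorem integral_norm_sq_div_finrank_sub_inner_sq_mul_gaussianWeight_nonneg (hP : 0 < P) {a : E}
    (ha : ‖a‖ ≤ 1) :
    0 ≤ ∫ w : E, (‖w‖ ^ 2 / finrank ℝ E - ⟪a, w⟫ ^ 2) * gaussianWeight P w := by
  have hq := integrable_norm_sq_mul_gaussianWeight (E := E) hP
  rcases subsingleton_or_nontrivial E with hE | hE
  · simp [Subsingleton.elim _ (0 : E)]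
  have hd : (0 : ℝ) < finrank ℝ E := by exact_mod_cast finrank_pos
  simp only [sub_mul, div_mul_eq_mul_div]
  rw [integral_sub (hq.div_const _) (integrable_inner_sq_mul hq a), integral_div, sub_nonneg,
    le_div_iff₀' hd]
  refine (finrank_mul_integral_inner_sq_mul_radial (fun r => Real.exp (-(P / 2) * r ^ 2)) hq
    a).trans_le (mul_le_of_le_one_left ?_ (pow_le_one₀ (norm_nonneg a) ha))
  exact integral_nonneg fun w => by positivity

theorem integrable_gaussianWeight_add_mul {Q : ℝ} (hP : 0 < P) (hQ : 0 ≤ Q) (y : E) :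
    Integrable fun w : E => gaussianWeight Q (y + w) * gaussianWeight P w := by
  have hcont := continuous_gaussianWeight (E := E) Q
  refine (integrable_gaussianWeight hP).bdd_mul (c := 1) (by fun_prop) (ae_of_all _ fun w => ?_)
  rw [Real.norm_of_nonneg (gaussianWeight_nonneg Q _)]
  exact gaussianWeight_le_one hQ _

theorem integral_gaussianWeight_add_mul_le {Q : ℝ} (hP : 0 < P) (hQ : 0 ≤ Q) {y : E}
    (hy : Q * ‖y‖ ^ 2 ≤ finrank ℝ E) :
    ∫ w : E, gaussianWeight Q (y + w) * gaussianWeight P w ≤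
      gaussianWeight Q y * ∫ w : E, gaussianWeight P w := by
  set s : ℝ := finrank ℝ E / 2
  have : 0 ≤ s := by positivity
  have hPQ : 0 < P + Q := by linarith
  have hexp : gaussianWeight (P * Q / (P + Q)) y ≤
      gaussianWeight Q y * Real.exp (Q / (P + Q)) ^ s := by
    rw [gaussianWeight, gaussianWeight, ← Real.exp_mul, ← Real.exp_add, Real.exp_le_exp]
    have := mul_le_mul_of_nonneg_left hy (by positivity : 0 ≤ Q / (P + Q) / 2)
    calc -(P * Q / (P + Q) / 2) * ‖y‖ ^ 2
        = -(Q / 2) * ‖y‖ ^ 2 + Q / (P + Q) / 2 * (Q * ‖y‖ ^ 2) := by field_simp; ring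
      _ ≤ -(Q / 2) * ‖y‖ ^ 2 + Q / (P + Q) / 2 * finrank ℝ E := by gcongr
      _ = -(Q / 2) * ‖y‖ ^ 2 + Q / (P + Q) * s := by simp only [s]; ring
  have hratio : Real.exp (Q / (P + Q)) * (2 * Real.pi / (P + Q)) ≤ 2 * Real.pi / P := by
    have h : P / (P + Q) ≤ Real.exp (-(Q / (P + Q))) := by
      refine Eq.trans_le ?_ (Real.one_sub_le_exp_neg _)
      field_simp
      ring
    rw [Real.exp_neg, le_inv_comm₀ (by positivity) (by positivity), inv_div] at h
    refine (mul_le_mul_of_nonneg_right h (by positivity)).trans_eq ?_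
    field_simp
  simp only [gaussianWeight_add_mul_gaussianWeight hPQ.ne']
  rw [integral_const_mul, integral_add_right_eq_self (gaussianWeight (P + Q)),
    integral_gaussianWeight hPQ, integral_gaussianWeight hP]
  calc gaussianWeight (P * Q / (P + Q)) y * (2 * Real.pi / (P + Q)) ^ s
      ≤ gaussianWeight Q y * Real.exp (Q / (P + Q)) ^ s * (2 * Real.pi / (P + Q)) ^ s := by gcongr
    _ = gaussianWeight Q y * (Real.exp (Q / (P + Q)) * (2 * Real.pi / (P + Q))) ^ s := by
        rw [mul_assoc, Real.mul_rpow (Real.exp_pos _).le (by positivity)]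
    _ ≤ gaussianWeight Q y * (2 * Real.pi / P) ^ s := by
        have := gaussianWeight_nonneg Q y
        gcongr

end Gaussian

section SelfNormalized

section Exponent

variable {E : Type*} [NormedAddCommGroup E] [InnerProductSpace ℝ E]

/-- The exponent `∑_{i < n} (⟪y, a_i⟫ η_i - ⟪y, a_i⟫²)` of the self-normalized process in direction
`y`, for actions `a` and noise `η`. For `1`-sub-Gaussian noise a compensator `⟪y, a_i⟫² / 2` would
make it a supermartingale; the other half is kept to be averaged over the choice of action. -/
def selfNormExponent (a : ℕ → E) (η : ℕ → ℝ) (n : ℕ) (y : E) : ℝ :=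
  ∑ i ∈ Finset.range n, (⟪y, a i⟫ * η i - ⟪y, a i⟫ ^ 2)

/-- The exponent of the mixture over directions `y`: the self-normalized exponent, compensated by
its mean decay `κ` per sample, with a Gaussian weight of precision `lam`. -/
def mixtureExponent (a : ℕ → E) (η : ℕ → ℝ) (n : ℕ) (lam κ : ℝ) (y : E) : ℝ :=
  selfNormExponent a η n y + n * ((1 - Real.exp (-(‖y‖ ^ 2 / 2))) * κ) - lam / 2 * ‖y‖ ^ 2

theorem measurable_selfNormExponent [SecondCountableTopology E] [MeasurableSpace E]
    [OpensMeasurableSpace E] {α : Type*} {m : MeasurableSpace α} {a : ℕ → α → E}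
    {η : ℕ → α → ℝ} {n : ℕ} (ha : ∀ i < n, Measurable (a i)) (hη : ∀ i < n, Measurable (η i))
    {y : α → E} (hy : Measurable y) :
    Measurable fun ω => selfNormExponent (a · ω) (η · ω) n (y ω) := by
  refine Finset.measurable_fun_sum _ fun i hi => ?_
  have hai := ha i (Finset.mem_range.1 hi)
  have hηi := hη i (Finset.mem_range.1 hi)
  fun_prop

end Exponent

namespace IsOffClusBand

variable {Ω : Type*} {mΩ : MeasurableSpace Ω} {μ : Measure Ω} {U d S : ℕ}
  {D : OfflineData Ω U d} {θ : Fin U → Vec d} {ρ : Measure (Vec d)} {lamA : ℝ} {σ : ℝ≥0}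
  {past : (u : Fin U) → Filtration ℕ mΩ} {u : Fin U}

theorem preReward_le (hD : IsOffClusBand μ D θ ρ S past) {i : ℕ} (hi : i < D.N u) :
    preReward D past u i ≤ past u (i + 1) :=
  sup_le (sup_le ((past u).mono i.le_succ)
    (iSup_le fun j => (hD.measurable_cand u i hi j).comap_le))
    (hD.measurable_action u i hi).comap_le

theorem measurable_noise (hD : IsOffClusBand μ D θ ρ S past) {i : ℕ} (hi : i < D.N u) :
    Measurable[past u (i + 1)] (noise D θ u i) := by
  have haction := hD.measurable_action u i hi
  have hreward := hD.measurable_reward u i hi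
  unfold noise
  fun_prop

theorem measurable_past_selfNormExponent (hD : IsOffClusBand μ D θ ρ S past) (y : Vec d) {n : ℕ}
    (hn : n ≤ D.N u) :
    Measurable[past u n] fun ω => selfNormExponent (D.action u · ω) (noise D θ u · ω) n y :=
  measurable_selfNormExponent (m := past u n) (a := D.action u) (η := noise D θ u)
    (fun i hi => (hD.measurable_action u i (hi.trans_le hn)).mono ((past u).mono hi) le_rfl)
    (fun _ hi => (hD.measurable_noise (hi.trans_le hn)).mono ((past u).mono hi) le_rfl)
    (y := fun _ => y) measurable_const

theorem measurable_mixtureExponent (hD : IsOffClusBand μ D θ ρ S past) (u : Fin U) (lam κ : ℝ) :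
    Measurable fun p : Ω × Vec d => mixtureExponent (D.action u · p.1) (noise D θ u · p.1) (D.N u)
      lam κ p.2 := by
  have hself := measurable_selfNormExponent (n := D.N u)
    (a := fun i (p : Ω × Vec d) => D.action u i p.1) (η := fun i p => noise D θ u i p.1)
    (fun i hi => ((hD.measurable_action u i hi).mono ((past u).le _) le_rfl).comp measurable_fst)
    (fun i hi => ((hD.measurable_noise hi).mono ((past u).le _) le_rfl).comp measurable_fst)
    measurable_snd
  unfold mixtureExponent
  fun_prop

theorem lintegral_mul_exp_noise_le [IsFiniteMeasure μ] (hD : IsOffClusBand μ D θ ρ S past) {n : ℕ}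
    (hn : n < D.N u) (y : Vec d) {X : Ω → ℝ≥0∞} (hX : Measurable[preReward D past u n] X) :
    ∫⁻ ω, X ω * ENNReal.ofReal (Real.exp (⟪y, D.action u n ω⟫ * noise D θ u n ω
      - ⟪y, D.action u n ω⟫ ^ 2 / 2)) ∂μ ≤ ∫⁻ ω, X ω ∂μ := by
  have haction : Measurable[preReward D past u n] (D.action u n) :=
    (comap_measurable _).mono le_sup_right le_rfl
  have hpast := (past u).le (n + 1)
  exact lintegral_mul_exp_sub_le_of_condExp_le ((hD.preReward_le hn).trans hpast)
    ((hD.measurable_noise hn).mono hpast le_rfl) (hD.integrable_exp_noise u n hn)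
    (ψ := fun t => t ^ 2 / 2) (by fun_prop) (hD.noise_subgaussian u n hn)
    (τ := fun ω => ⟪y, D.action u n ω⟫) (by fun_prop) hX

variable [IsProbabilityMeasure μ]

theorem nonempty_cand (hD : IsOffClusBand μ D θ ρ S past) {i : ℕ} (hi : i < D.N u) :
    Nonempty (Fin (D.numCand u i)) := by
  obtain ⟨ω, j, -⟩ := (hD.action_mem u i hi).exists
  exact ⟨j⟩

/-- Exploration: whichever candidate is logged, its squared component is at least `minSq`, which is
independent of the past. -/
theorem lintegral_mul_exp_neg_inner_sq_le (hρ : RegularActionLaw ρ lamA σ)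
    (hD : IsOffClusBand μ D θ ρ S past) {n : ℕ} (hn : n < D.N u) (y : Vec d)
    {X : Ω → ℝ≥0∞} (hX : Measurable[past u n] X) :
    ∫⁻ ω, X ω * ENNReal.ofReal (Real.exp (-(⟪y, D.action u n ω⟫ ^ 2 / 2))) ∂μ ≤
      (∫⁻ ω, X ω ∂μ) * ENNReal.ofReal (Real.exp
        (-((1 - Real.exp (-(‖y‖ ^ 2 / 2))) * smoothedRegularity lamA σ S))) := by
  have := hD.nonempty_cand hn
  have hcand : ∀ j, Measurable (D.cand u n j) := fun j =>
    (hD.measurable_cand u n hn j).mono ((past u).le _) le_rfl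
  set mc : MeasurableSpace Ω := ⨆ j, MeasurableSpace.comap (D.cand u n j) inferInstance
  have hmin : Measurable[mc] (minSq (D.cand u n) y) := measurable_minSq (m := mc)
    (fun j => (comap_measurable _).mono
      (le_iSup (fun j => MeasurableSpace.comap (D.cand u n j) inferInstance) j) le_rfl) y
  calc ∫⁻ ω, X ω * ENNReal.ofReal (Real.exp (-(⟪y, D.action u n ω⟫ ^ 2 / 2))) ∂μ
      ≤ ∫⁻ ω, X ω * ENNReal.ofReal (Real.exp (-(minSq (D.cand u n) y ω / 2))) ∂μ := by
        refine lintegral_mono_ae ?_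
        filter_upwards [hD.action_mem u n hn] with ω ⟨j, hj⟩
        rw [hj]
        gcongr
        exact minSq_le y ω j
    _ = (∫⁻ ω, X ω ∂μ) * ∫⁻ ω, ENNReal.ofReal (Real.exp (-(minSq (D.cand u n) y ω / 2))) ∂μ :=
        lintegral_mul_eq_lintegral_mul_lintegral_of_independent_measurableSpace ((past u).le n)
          (iSup_le fun j => (hcand j).comap_le) (hD.cand_indep_past u n hn).symm hX
          (by fun_prop)
    _ ≤ _ := by
        gcongr
        exact hρ.lintegral_exp_neg_minSq_div_two_le (by simpa using hD.numCand_le u n hn) hcand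
          (hD.cand_law u n hn) (hD.cand_iIndep u n hn) y

theorem lintegral_exp_selfNormExponent_succ_le (hρ : RegularActionLaw ρ lamA σ)
    (hD : IsOffClusBand μ D θ ρ S past) {n : ℕ} (hn : n < D.N u) (y : Vec d) :
    ∫⁻ ω, ENNReal.ofReal (Real.exp
        (selfNormExponent (D.action u · ω) (noise D θ u · ω) (n + 1) y)) ∂μ ≤
      (∫⁻ ω, ENNReal.ofReal (Real.exp
        (selfNormExponent (D.action u · ω) (noise D θ u · ω) n y)) ∂μ) *
        ENNReal.ofReal (Real.exp
          (-((1 - Real.exp (-(‖y‖ ^ 2 / 2))) * smoothedRegularity lamA σ S))) := by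
  set X : Ω → ℝ≥0∞ := fun ω => ENNReal.ofReal (Real.exp
    (selfNormExponent (D.action u · ω) (noise D θ u · ω) n y))
  have hX : Measurable[past u n] X :=
    (hD.measurable_past_selfNormExponent y hn.le).exp.ennreal_ofReal
  have haction : Measurable[preReward D past u n] (D.action u n) :=
    (comap_measurable _).mono le_sup_right le_rfl
  have hXpre : Measurable[preReward D past u n] X := hX.mono (le_sup_left.trans le_sup_left) le_rfl
  calc ∫⁻ ω, ENNReal.ofReal (Real.exp
        (selfNormExponent (D.action u · ω) (noise D θ u · ω) (n + 1) y)) ∂μ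
      = ∫⁻ ω, X ω * ENNReal.ofReal (Real.exp (-(⟪y, D.action u n ω⟫ ^ 2 / 2))) *
          ENNReal.ofReal (Real.exp (⟪y, D.action u n ω⟫ * noise D θ u n ω
            - ⟪y, D.action u n ω⟫ ^ 2 / 2)) ∂μ := by
        refine lintegral_congr fun ω => ?_
        rw [← ENNReal.ofReal_mul (Real.exp_pos _).le, ← ENNReal.ofReal_mul (by positivity),
          ← Real.exp_add, ← Real.exp_add, selfNormExponent, Finset.sum_range_succ,
          ← selfNormExponent]
        congr 2
        ring
    _ ≤ ∫⁻ ω, X ω * ENNReal.ofReal (Real.exp (-(⟪y, D.action u n ω⟫ ^ 2 / 2))) ∂μ :=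
        hD.lintegral_mul_exp_noise_le hn y (hXpre.mul (by fun_prop))
    _ ≤ _ := hD.lintegral_mul_exp_neg_inner_sq_le hρ hn y hX

theorem lintegral_exp_selfNormExponent_le (hρ : RegularActionLaw ρ lamA σ)
    (hD : IsOffClusBand μ D θ ρ S past) (y : Vec d) {n : ℕ} (hn : n ≤ D.N u) :
    ∫⁻ ω, ENNReal.ofReal (Real.exp
        (selfNormExponent (D.action u · ω) (noise D θ u · ω) n y)) ∂μ ≤
      ENNReal.ofReal (Real.exp
        (-(n * ((1 - Real.exp (-(‖y‖ ^ 2 / 2))) * smoothedRegularity lamA σ S)))) := by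
  induction n with
  | zero => simp [selfNormExponent]
  | succ n ih =>
    refine (hD.lintegral_exp_selfNormExponent_succ_le hρ hn y).trans ?_
    refine (mul_le_mul_left (ih (Nat.le_of_succ_le hn)) _).trans_eq ?_
    rw [← ENNReal.ofReal_mul (Real.exp_pos _).le, ← Real.exp_add]
    congr 2
    push_cast
    ring

theorem lintegral_exp_mixtureExponent_le (hρ : RegularActionLaw ρ lamA σ)
    (hD : IsOffClusBand μ D θ ρ S past) (lam : ℝ) (u : Fin U) (y : Vec d) :
    ∫⁻ ω, ENNReal.ofReal (Real.exp (mixtureExponent (D.action u · ω) (noise D θ u · ω) (D.N u)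
      lam (smoothedRegularity lamA σ S) y)) ∂μ ≤
      ENNReal.ofReal (gaussianWeight lam y) := by
  set c := D.N u * ((1 - Real.exp (-(‖y‖ ^ 2 / 2))) * smoothedRegularity lamA σ S)
  calc _ = ∫⁻ ω, ENNReal.ofReal (Real.exp
          (selfNormExponent (D.action u · ω) (noise D θ u · ω) (D.N u) y)) *
          ENNReal.ofReal (Real.exp (c - lam / 2 * ‖y‖ ^ 2)) ∂μ := by
        refine lintegral_congr fun ω => ?_
        rw [← ENNReal.ofReal_mul (Real.exp_pos _).le, ← Real.exp_add, mixtureExponent,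
          add_sub_assoc]
    _ ≤ ENNReal.ofReal (Real.exp (-c)) *
          ENNReal.ofReal (Real.exp (c - lam / 2 * ‖y‖ ^ 2)) := by
        rw [lintegral_mul_const' _ _ ENNReal.ofReal_ne_top]
        gcongr
        exact hD.lintegral_exp_selfNormExponent_le hρ y le_rfl
    _ = _ := by
        rw [← ENNReal.ofReal_mul (Real.exp_pos _).le, ← Real.exp_add, gaussianWeight]
        congr 2
        ring

theorem lintegral_lintegral_exp_mixtureExponent_le (hρ : RegularActionLaw ρ lamA σ)
    (hD : IsOffClusBand μ D θ ρ S past) {lam : ℝ} (hlam : 0 < lam) (u : Fin U) :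
    ∫⁻ ω, (∫⁻ y, ENNReal.ofReal (Real.exp (mixtureExponent (D.action u · ω) (noise D θ u · ω)
      (D.N u) lam (smoothedRegularity lamA σ S) y))) ∂μ ≤
      ENNReal.ofReal ((2 * Real.pi / lam) ^ (d / 2 : ℝ)) := by
  have hmeas := (hD.measurable_mixtureExponent u lam (smoothedRegularity lamA σ S)
    ).exp.ennreal_ofReal
  rw [lintegral_lintegral_swap hmeas.aemeasurable]
  refine (lintegral_mono fun y => hD.lintegral_exp_mixtureExponent_le hρ lam u y).trans_eq ?_
  rw [← ofReal_integral_eq_lintegral_ofReal (integrable_gaussianWeight hlam)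
    (ae_of_all _ (gaussianWeight_nonneg lam)), integral_gaussianWeight hlam,
    finrank_euclideanSpace, Fintype.card_fin]

end IsOffClusBand

end SelfNormalized

section Mixture

variable {E : Type*} [NormedAddCommGroup E] [InnerProductSpace ℝ E] {a : ℕ → E} {n : ℕ} {κ P : ℝ}
  {y : E}

/-- The increment of the mixture exponent from `y` to `y + w`, with the linear part collected into
`l`, once the quadratic terms `(lam / 2 + n / finrank ℝ E) ‖w‖²` are moved into a Gaussian
weight. -/
def mixtureIncrement (a : ℕ → E) (n : ℕ) (κ : ℝ) (y l w : E) : ℝ :=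
  ⟪l, w⟫ + ∑ i ∈ Finset.range n, (‖w‖ ^ 2 / finrank ℝ E - ⟪a i, w⟫ ^ 2) +
    n * κ * (gaussianWeight 1 y - gaussianWeight 1 (y + w))

theorem selfNormExponent_add (a : ℕ → E) (η : ℕ → ℝ) (n : ℕ) (y w : E) :
    selfNormExponent a η n (y + w) = selfNormExponent a η n y +
      ⟪∑ i ∈ Finset.range n, (η i - 2 * ⟪y, a i⟫) • a i, w⟫ -
      ∑ i ∈ Finset.range n, ⟪a i, w⟫ ^ 2 := by
  simp only [selfNormExponent, sum_inner, ← Finset.sum_add_distrib, ← Finset.sum_sub_distrib]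
  refine Finset.sum_congr rfl fun i _ => ?_
  rw [inner_add_left, real_inner_smul_left, real_inner_comm w (a i)]
  ring

theorem exists_exp_mixtureExponent_add_eq (a : ℕ → E) (η : ℕ → ℝ) (n : ℕ) (lam κ : ℝ) (y : E) :
    ∃ l, ∀ w, Real.exp (mixtureExponent a η n lam κ (y + w)) =
      Real.exp (mixtureExponent a η n lam κ y) *
        (Real.exp (mixtureIncrement a n κ y l w) *
          gaussianWeight (lam + 2 * n / finrank ℝ E) w) := by
  refine ⟨(∑ i ∈ Finset.range n, (η i - 2 * ⟪y, a i⟫) • a i) - lam • y, fun w => ?_⟩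
  rw [gaussianWeight, ← Real.exp_add, ← Real.exp_add]
  congr 1
  simp only [mixtureExponent, mixtureIncrement, selfNormExponent_add, gaussianWeight_one,
    norm_add_sq_real, inner_sub_left, real_inner_smul_left, Finset.sum_sub_distrib,
    Finset.sum_const, Finset.card_range, nsmul_eq_mul]
  ring

variable [MeasurableSpace E] [BorelSpace E] [FiniteDimensional ℝ E]

theorem integral_gaussianWeight_sub_shift_mul_nonneg (hP : 0 < P) (hy : ‖y‖ ^ 2 ≤ finrank ℝ E) :
    0 ≤ ∫ w, (gaussianWeight 1 y * gaussianWeight P w -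
      gaussianWeight 1 (y + w) * gaussianWeight P w) := by
  rw [integral_sub ((integrable_gaussianWeight hP).const_mul _)
    (integrable_gaussianWeight_add_mul hP zero_le_one y), integral_const_mul]
  exact sub_nonneg.2 (integral_gaussianWeight_add_mul_le hP zero_le_one (by rwa [one_mul]))

theorem integrable_mixtureIncrement_mul_gaussianWeight_and_integral_nonneg (hP : 0 < P)
    (ha : ∀ i < n, ‖a i‖ ≤ 1) (hκ : 0 ≤ κ) (hy : ‖y‖ ^ 2 ≤ finrank ℝ E) (l : E) :
    Integrable (fun w => mixtureIncrement a n κ y l w * gaussianWeight P w) ∧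
      0 ≤ ∫ w, mixtureIncrement a n κ y l w * gaussianWeight P w := by
  have hq := integrable_gaussianWeight (E := E) hP
  have hlin := integrable_inner_mul hq (integrable_norm_sq_mul_gaussianWeight hP) l
  have hquad := fun i => integrable_norm_sq_div_sub_inner_sq_mul_gaussianWeight hP
    (finrank ℝ E) (a i)
  have hsum := integrable_finsetSum (Finset.range n) fun i _ => hquad i
  have hshift := integrable_gaussianWeight_add_mul hP zero_le_one y
  have hbonus : Integrable fun w => n * κ * (gaussianWeight 1 y * gaussianWeight P w -
      gaussianWeight 1 (y + w) * gaussianWeight P w) := ((hq.const_mul _).sub hshift).const_mul _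
  have hlin_zero : ∫ w, ⟪l, w⟫ * gaussianWeight P w = 0 :=
    integral_inner_mul_radial (fun r => Real.exp (-(P / 2) * r ^ 2)) l
  have hsum_nonneg : 0 ≤ ∫ w, ∑ i ∈ Finset.range n,
      (‖w‖ ^ 2 / finrank ℝ E - ⟪a i, w⟫ ^ 2) * gaussianWeight P w := by
    rw [integral_finsetSum _ fun i _ => hquad i]
    exact Finset.sum_nonneg fun i hi =>
      integral_norm_sq_div_finrank_sub_inner_sq_mul_gaussianWeight_nonneg hP
        (ha i (Finset.mem_range.1 hi))
  have hbonus_nonneg : 0 ≤ ∫ w, n * κ * (gaussianWeight 1 y * gaussianWeight P w -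
      gaussianWeight 1 (y + w) * gaussianWeight P w) := by
    rw [integral_const_mul]
    exact mul_nonneg (by positivity) (integral_gaussianWeight_sub_shift_mul_nonneg hP hy)
  have hsplit : ∀ w, mixtureIncrement a n κ y l w * gaussianWeight P w =
      ⟪l, w⟫ * gaussianWeight P w +
        (∑ i ∈ Finset.range n, (‖w‖ ^ 2 / finrank ℝ E - ⟪a i, w⟫ ^ 2) * gaussianWeight P w +
        n * κ * (gaussianWeight 1 y * gaussianWeight P w -
          gaussianWeight 1 (y + w) * gaussianWeight P w)) := fun w => by
    rw [mixtureIncrement, ← Finset.sum_mul]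
    ring
  simp only [hsplit]
  refine ⟨hlin.fun_add (hsum.fun_add hbonus), ?_⟩
  rw [integral_add hlin (hsum.fun_add hbonus), integral_add hsum hbonus, hlin_zero, zero_add]
  exact add_nonneg hsum_nonneg hbonus_nonneg

theorem ofReal_exp_mixtureExponent_mul_le_lintegral {lam : ℝ} (η : ℕ → ℝ) (hlam : 0 < lam)
    (ha : ∀ i < n, ‖a i‖ ≤ 1) (hκ : 0 ≤ κ) (hy : ‖y‖ ^ 2 ≤ finrank ℝ E) :
    ENNReal.ofReal (Real.exp (mixtureExponent a η n lam κ y) *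
        (2 * Real.pi / (lam + 2 * n / finrank ℝ E)) ^ (finrank ℝ E / 2 : ℝ)) ≤
      ∫⁻ v, ENNReal.ofReal (Real.exp (mixtureExponent a η n lam κ v)) := by
  have hP : 0 < lam + 2 * n / finrank ℝ E := by positivity
  obtain ⟨l, hl⟩ := exists_exp_mixtureExponent_add_eq a η n lam κ y
  rw [← lintegral_add_left_eq_self _ y]
  simp only [hl, ENNReal.ofReal_mul (Real.exp_pos (mixtureExponent a η n lam κ y)).le]
  rw [lintegral_const_mul' _ _ ENNReal.ofReal_ne_top, ← integral_gaussianWeight hP]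
  obtain ⟨hint, hnonneg⟩ :=
    integrable_mixtureIncrement_mul_gaussianWeight_and_integral_nonneg hP ha hκ hy l
  gcongr
  exact ofReal_integral_le_lintegral_exp_mul (gaussianWeight_nonneg _)
    (integrable_gaussianWeight hP) hint hnonneg

end Mixture

section Ridge

open scoped Matrix

variable {Ω : Type*} {U d : ℕ} (D : OfflineData Ω U d) {lam : ℝ} (u : Fin U) (ω : Ω)

theorem posDef_gram (hlam : 0 < lam) : (gram D lam u ω).PosDef := by
  refine Matrix.PosDef.add_posSemidef (Matrix.PosDef.one.smul hlam)
    (Matrix.posSemidef_sum _ fun i _ => ?_)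
  simpa using Matrix.posSemidef_vecMulVec_self_star (D.action u i ω).ofLp

theorem gram_mulVec (x : Vec d) :
    gram D lam u ω *ᵥ x.ofLp =
      (lam • x + ∑ i ∈ Finset.range (D.N u), ⟪D.action u i ω, x⟫ • D.action u i ω).ofLp := by
  simp only [gram, Matrix.add_mulVec, Matrix.smul_mulVec, Matrix.one_mulVec, Matrix.sum_mulVec,
    Matrix.vecMulVec_mulVec, op_smul_eq_smul, EuclideanSpace.inner_eq_star_dotProduct, star_trivial,
    WithLp.ofLp_add, WithLp.ofLp_smul, WithLp.ofLp_sum, dotProduct_comm x.ofLp]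

theorem ridge_normal_equation (hlam : 0 < lam) :
    lam • ridge D lam u ω + ∑ i ∈ Finset.range (D.N u),
      ⟪D.action u i ω, ridge D lam u ω⟫ • D.action u i ω = moment D u ω := by
  have hdet : IsUnit (gram D lam u ω).det :=
    (Matrix.isUnit_iff_isUnit_det _).1 (posDef_gram D u ω hlam).isUnit
  refine WithLp.ofLp_injective 2 ?_
  rw [← gram_mulVec, ridge, Matrix.mulVec_mulVec, Matrix.mul_nonsing_inv _ hdet,
    Matrix.one_mulVec]

theorem selfNormExponent_smul_ridge_sub (θ : Fin U → Vec d) (hlam : 0 < lam) (τ : ℝ) :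
    selfNormExponent (D.action u · ω) (noise D θ u · ω) (D.N u) (τ • (ridge D lam u ω - θ u)) =
      τ * (1 - τ) * ∑ i ∈ Finset.range (D.N u), ⟪ridge D lam u ω - θ u, D.action u i ω⟫ ^ 2 +
        τ * (lam * ⟪ridge D lam u ω - θ u, ridge D lam u ω⟫) := by
  set e := ridge D lam u ω - θ u with he
  have hnormal := congrArg (⟪e, ·⟫) (ridge_normal_equation D u ω hlam)
  simp only [moment, inner_add_right, inner_sum, real_inner_smul_right] at hnormal
  rw [eq_sub_of_add_eq hnormal, selfNormExponent, ← Finset.sum_sub_distrib, Finset.mul_sum,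
    Finset.mul_sum, ← Finset.sum_add_distrib]
  refine Finset.sum_congr rfl fun i _ => ?_
  rw [noise, ← sub_sub_cancel (ridge D lam u ω) (θ u), ← he, inner_sub_left,
    real_inner_smul_left, real_inner_comm (ridge D lam u ω) (D.action u i ω)]
  ring

theorem exists_norm_eq_and_le_selfNormExponent {θ : Fin U → Vec d} (hlam : 0 < lam)
    (hθ : ‖θ u‖ ≤ 1) {r : ℝ} (hr0 : 0 ≤ r) (hr : r < ‖ridge D lam u ω - θ u‖) :
    ∃ y : Vec d, ‖y‖ = r ∧
      lam * r * (r - 1) ≤ selfNormExponent (D.action u · ω) (noise D θ u · ω) (D.N u) y := by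
  set e := ridge D lam u ω - θ u with he
  have he0 : 0 < ‖e‖ := hr0.trans_lt hr
  have hτe : r / ‖e‖ * ‖e‖ = r := div_mul_cancel₀ _ he0.ne'
  have hτ0 : 0 ≤ r / ‖e‖ := by positivity
  refine ⟨(r / ‖e‖) • e, by rw [norm_smul, Real.norm_of_nonneg hτ0, hτe], ?_⟩
  have hquad : 0 ≤ r / ‖e‖ * (1 - r / ‖e‖) *
      ∑ i ∈ Finset.range (D.N u), ⟪e, D.action u i ω⟫ ^ 2 :=
    mul_nonneg (mul_nonneg hτ0 (sub_nonneg.2 ((div_le_one he0).2 hr.le)))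
      (Finset.sum_nonneg fun i _ => sq_nonneg _)
  have hinner : ‖e‖ * (r - 1) ≤ ⟪e, ridge D lam u ω⟫ := by
    have hcs := neg_le_of_abs_le (abs_real_inner_le_norm e (θ u))
    have hθe := mul_le_of_le_one_right he0.le hθ
    have hre := mul_le_mul_of_nonneg_left hr.le he0.le
    rw [← sub_add_cancel (ridge D lam u ω) (θ u), ← he, inner_add_right,
      real_inner_self_eq_norm_sq]
    linarith
  rw [selfNormExponent_smul_ridge_sub D u ω θ hlam, ← he]
  calc lam * r * (r - 1) = r / ‖e‖ * (lam * (‖e‖ * (r - 1))) := by field_simp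
    _ ≤ r / ‖e‖ * (lam * ⟪e, ridge D lam u ω⟫) := by gcongr
    _ ≤ _ := le_add_of_nonneg_left hquad

end Ridge

section Confidence

theorem three_eighths_mul_le_one_sub_exp {t : ℝ} (ht0 : 0 ≤ t) (ht1 : t ≤ 1) :
    3 / 8 * t ≤ 1 - Real.exp (-(t / 2)) := by
  have hconvex := exp_neg_mul_le_one_sub (s := 1 / 2) ht0 ht1
  have hexp : Real.exp (-(1 / 2)) ≤ 5 / 8 := by
    have := Real.quadratic_le_exp_of_nonneg (x := 1 / 2) (by norm_num)
    rw [Real.exp_neg]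
    exact inv_le_of_inv_le₀ (by norm_num) (by norm_num at this ⊢; linarith)
  rw [one_div_mul_eq_div] at hconvex
  linarith [mul_le_mul_of_nonneg_right hexp ht0]

theorem one_add_two_mul_rpow_le {x s : ℝ} (hx : 2 ≤ x) (hs : 0 ≤ s) :
    (1 + 2 * x) ^ s ≤ Real.exp (3 / 2 * (s * Real.log (1 + x))) := by
  have hlog : 2 * Real.log (1 + 2 * x) ≤ 3 * Real.log (1 + x) := by
    have hpow : (1 + 2 * x) ^ 2 ≤ (1 + x) ^ 3 := by
      nlinarith [mul_nonneg (sq_nonneg x) (sub_nonneg.2 hx)]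
    have := Real.log_le_log (by positivity) hpow
    rw [Real.log_pow, Real.log_pow] at this
    exact_mod_cast this
  rw [Real.rpow_def_of_pos (by linarith), Real.exp_le_exp]
  linarith [mul_le_mul_of_nonneg_left hlog hs]

section Width

variable {Ω : Type*} {U d : ℕ} (D : OfflineData Ω U d) (lam lamT δ : ℝ) (u : Fin U)

theorem confWidth_nonneg : 0 ≤ confWidth D lam lamT δ u :=
  div_nonneg (add_nonneg (Real.sqrt_nonneg _) (Real.sqrt_nonneg _)) (Real.sqrt_nonneg _)

variable {D lam lamT δ u} (hlam : 0 < lam) (hlamT : 0 < lamT) (hN : 0 < D.N u) (hδ : 0 < δ)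
  (hUδ : δ ≤ 2 * U)

include hδ hUδ in
theorem log_confidence_nonneg : 0 ≤ Real.log (2 * U / δ) :=
  Real.log_nonneg ((one_le_div hδ).2 hUδ)

include hlam hlamT hN hδ hUδ

theorem le_mul_confWidth_sq_div_two :
    d * Real.log (1 + D.N u / (lam * d)) + 2 * Real.log (2 * U / δ) + lam ≤
      D.N u * lamT * confWidth D lam lamT δ u ^ 2 / 2 := by
  set B := d * Real.log (1 + D.N u / (lam * d)) + 2 * Real.log (2 * U / δ)
  have hlog : 0 ≤ Real.log (1 + D.N u / (lam * d)) :=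
    Real.log_nonneg (le_add_of_nonneg_right (by positivity))
  have hconf := log_confidence_nonneg hδ hUδ
  have hB : 0 ≤ B := by positivity
  have : (0 : ℝ) < D.N u := by exact_mod_cast hN
  calc B + lam = √B ^ 2 + √lam ^ 2 := by rw [Real.sq_sqrt hB, Real.sq_sqrt hlam.le]
    _ ≤ (√B + √lam) ^ 2 := by
        nlinarith [mul_nonneg (Real.sqrt_nonneg B) (Real.sqrt_nonneg lam)]
    _ = D.N u * lamT * ((√B + √lam) / √(lamT * D.N u / 2)) ^ 2 / 2 := by
        rw [div_pow, Real.sq_sqrt (by positivity)]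
        field_simp

theorem two_le_div_of_confWidth_le_one (hd : 0 < d) (hdlamT : d * lamT ≤ 1)
    (hCI : confWidth D lam lamT δ u ≤ 1) : 2 ≤ D.N u / (lam * d) := by
  have hd' : (0 : ℝ) < d := by exact_mod_cast hd
  have hlog : 0 ≤ Real.log (1 + D.N u / (lam * d)) :=
    Real.log_nonneg (le_add_of_nonneg_right (by positivity))
  have hconf := log_confidence_nonneg hδ hUδ
  have hwidth := le_mul_confWidth_sq_div_two hlam hlamT hN hδ hUδ
  have hlam_le : lam ≤ D.N u * lamT / 2 := by
    have hCI2 := pow_le_one₀ (n := 2) (confWidth_nonneg D lam lamT δ u) hCI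
    have := mul_le_of_le_one_right (by positivity : 0 ≤ D.N u * lamT) hCI2
    linarith [mul_nonneg hd'.le hlog]
  rw [le_div_iff₀ (by positivity)]
  calc 2 * (lam * d) ≤ 2 * (D.N u * lamT / 2 * d) := by gcongr
    _ = D.N u * (d * lamT) := by ring
    _ ≤ D.N u := mul_le_of_le_one_right (Nat.cast_nonneg _) hdlamT

theorem le_mixtureExponent_of_le_selfNormExponent {a : ℕ → Vec d} {η : ℕ → ℝ} {y : Vec d}
    (hy : ‖y‖ = confWidth D lam lamT δ u) (hCI : confWidth D lam lamT δ u ≤ 1)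
    (hself : lam * confWidth D lam lamT δ u * (confWidth D lam lamT δ u - 1) ≤
      selfNormExponent a η (D.N u) y) :
    3 / 4 * (d * Real.log (1 + D.N u / (lam * d))) + Real.log (2 * U / δ) ≤
      mixtureExponent a η (D.N u) lam lamT y := by
  have hwidth := le_mul_confWidth_sq_div_two hlam hlamT hN hδ hUδ
  have hconf := log_confidence_nonneg hδ hUδ
  rw [mixtureExponent, hy]
  set r := confWidth D lam lamT δ u
  have hr0 : 0 ≤ r := confWidth_nonneg D lam lamT δ u
  have hdecay := mul_le_mul_of_nonneg_left (three_eighths_mul_le_one_sub_exp (sq_nonneg r)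
    (pow_le_one₀ hr0 hCI)) (by positivity : 0 ≤ D.N u * lamT)
  have hsquare : 0 ≤ lam * (r - 1) ^ 2 := by positivity
  linarith

end Width

variable {Ω : Type*} {mΩ : MeasurableSpace Ω} {μ : Measure Ω} {U d S : ℕ} {D : OfflineData Ω U d}
  {θ : Fin U → Vec d} {ρ : Measure (Vec d)} {lam lamT lamA δ : ℝ} {σ : ℝ≥0} {u : Fin U}
  {past : (u : Fin U) → Filtration ℕ mΩ}

theorem le_lintegral_exp_mixtureExponent {ω : Ω} (hd : 0 < d) (hlam : 0 < lam) (hlamT : 0 < lamT)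
    (hdlamT : d * lamT ≤ 1) (hN : 0 < D.N u) (hδ : 0 < δ) (hUδ : δ ≤ 2 * U) (hθ : ‖θ u‖ ≤ 1)
    (ha : ∀ i < D.N u, ‖D.action u i ω‖ ≤ 1) (hCI : confWidth D lam lamT δ u ≤ 1)
    (hmiss : confWidth D lam lamT δ u < ‖ridge D lam u ω - θ u‖) :
    ENNReal.ofReal (2 * U / δ * (2 * Real.pi / lam) ^ (d / 2 : ℝ)) ≤
      ∫⁻ y, ENNReal.ofReal (Real.exp
        (mixtureExponent (D.action u · ω) (noise D θ u · ω) (D.N u) lam lamT y)) := by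
  obtain ⟨y, hy, hself⟩ := exists_norm_eq_and_le_selfNormExponent D u ω hlam hθ
    (confWidth_nonneg D lam lamT δ u) hmiss
  have hexponent := le_mixtureExponent_of_le_selfNormExponent hlam hlamT hN hδ hUδ hy hCI hself
  have : (0 : ℝ) < d := by exact_mod_cast hd
  have hy1 : ‖y‖ ^ 2 ≤ finrank ℝ (Vec d) := by
    rw [finrank_euclideanSpace_fin]
    exact (pow_le_one₀ (norm_nonneg y) (hy.trans_le hCI)).trans (by exact_mod_cast hd)
  have hmixture := ofReal_exp_mixtureExponent_mul_le_lintegral (noise D θ u · ω) hlam ha hlamT.le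
    hy1
  have hx := two_le_div_of_confWidth_le_one hlam hlamT hN hδ hUδ hd hdlamT hCI
  rw [finrank_euclideanSpace_fin] at hmixture
  refine le_trans (ENNReal.ofReal_le_ofReal ?_) hmixture
  have hU : (0 : ℝ) < 2 * U := hδ.trans_le hUδ
  set x : ℝ := D.N u / (lam * d) with hx_def
  have hfactor : 2 * Real.pi / lam = (1 + 2 * x) * (2 * Real.pi / (lam + 2 * D.N u / d)) := by
    rw [hx_def]
    field_simp
  rw [hfactor, Real.mul_rpow (by positivity) (by positivity), ← mul_assoc]
  gcongr
  calc 2 * U / δ * (1 + 2 * x) ^ (d / 2 : ℝ)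
      ≤ Real.exp (Real.log (2 * U / δ)) * Real.exp (3 / 2 * (d / 2 * Real.log (1 + x))) := by
        rw [Real.exp_log (by positivity)]
        gcongr
        exact one_add_two_mul_rpow_le hx (by positivity)
    _ ≤ _ := by
        rw [← Real.exp_add, Real.exp_le_exp]
        linarith

theorem IsOffClusBand.norm_action_le_one (hρ : RegularActionLaw ρ lamA σ)
    (hD : IsOffClusBand μ D θ ρ S past) (u : Fin U) :
    ∀ᵐ ω ∂μ, ∀ i < D.N u, ‖D.action u i ω‖ ≤ 1 := by
  refine ae_all_iff.2 fun i => Filter.eventually_imp_distrib_left.2 fun hi => ?_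
  have hcand : ∀ᵐ ω ∂μ, ∀ j, ‖D.cand u i j ω‖ ≤ 1 := ae_all_iff.2 fun j =>
    ae_of_ae_map ((hD.measurable_cand u i hi j).mono ((past u).le _) le_rfl).aemeasurable
      ((hD.cand_law u i hi j).symm ▸ hρ.norm_le_one)
  filter_upwards [hcand, hD.action_mem u i hi] with ω hω ⟨j, hj⟩
  exact hj ▸ hω j

theorem IsOffClusBand.measureReal_confWidth_lt_le [IsProbabilityMeasure μ]
    (hρ : RegularActionLaw ρ lamA σ) (hD : IsOffClusBand μ D θ ρ S past) (hlam : 0 < lam)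
    (hδ : 0 < δ) (hN : 0 < D.N u) (hθ : ‖θ u‖ ≤ 1) :
    μ.real {ω | confWidth D lam (smoothedRegularity lamA σ S) δ u ≤ 1 ∧
        confWidth D lam (smoothedRegularity lamA σ S) δ u < ‖ridge D lam u ω - θ u‖} ≤
      δ / (2 * U) := by
  set lamT := smoothedRegularity lamA σ S
  have hU : (0 : ℝ) < U := by exact_mod_cast Fin.pos u
  rcases lt_or_ge (2 * (U : ℝ)) δ with hUδ | hUδ
  · exact measureReal_le_one.trans ((one_le_div (by positivity)).2 hUδ.le)
  by_cases hCI : confWidth D lam lamT δ u ≤ 1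
  swap
  · simp only [hCI, false_and, Set.ofPred_false, measureReal_empty]
    positivity
  have hlamT : 0 < lamT := smoothedRegularity_pos hρ.lamA_pos hρ.sigma_pos S
  have hdlamT : d * lamT ≤ 1 := (mul_le_mul_of_nonneg_left
    (smoothedRegularity_le hρ.lamA_pos.le σ S) d.cast_nonneg).trans hρ.dim_mul_le_one
  set g : ℝ := (2 * Real.pi / lam) ^ (d / 2 : ℝ)
  have hg : 0 < g := by positivity
  set M : Ω → ℝ≥0∞ := fun ω => ∫⁻ y, ENNReal.ofReal (Real.exp
    (mixtureExponent (D.action u · ω) (noise D θ u · ω) (D.N u) lam lamT y))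
  have hM : Measurable M :=
    (hD.measurable_mixtureExponent u lam lamT).exp.ennreal_ofReal.lintegral_prod_right'
  have hfloor : 0 < 2 * U / δ * g := by positivity
  refine ENNReal.toReal_le_of_le_ofReal (by positivity) ?_
  calc _ ≤ μ {ω | ENNReal.ofReal (2 * U / δ * g) ≤ M ω} := by
        refine measure_mono_ae ?_
        filter_upwards [hD.norm_action_le_one hρ u] with ω ha hω
        exact le_lintegral_exp_mixtureExponent hρ.dim_pos hlam hlamT hdlamT hN hδ hUδ hθ ha hCI
          hω.2
    _ ≤ (∫⁻ ω, M ω ∂μ) / ENNReal.ofReal (2 * U / δ * g) :=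
        meas_ge_le_lintegral_div hM.aemeasurable (by simpa using hfloor) ENNReal.ofReal_ne_top
    _ ≤ ENNReal.ofReal g / ENNReal.ofReal (2 * U / δ * g) := by
        gcongr
        exact hD.lintegral_lintegral_exp_mixtureExponent_le hρ hlam u
    _ = ENNReal.ofReal (δ / (2 * U)) := by
        rw [← ENNReal.ofReal_div_of_pos hfloor]
        congr 1
        field_simp

end Confidence

section Policy

variable {Ω : Type*} {U d : ℕ} {D : OfflineData Ω U d} {θ : Fin U → Vec d}
  {lam lamT δ α γ : ℝ} {ω : Ω}

theorem lowerGap_le_norm_sub (hα : 1 ≤ α) {u v : Fin U}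
    (hu : ‖ridge D lam u ω - θ u‖ ≤ confWidth D lam lamT δ u)
    (hv : ‖ridge D lam v ω - θ v‖ ≤ confWidth D lam lamT δ v) :
    lowerGap D lam lamT δ α u v ω ≤ ‖θ u - θ v‖ := by
  have hα_le := le_mul_of_one_le_left
    (add_nonneg ((norm_nonneg _).trans hu) ((norm_nonneg _).trans hv)) hα
  have htri := dist_triangle4 (ridge D lam u ω) (θ u) (θ v) (ridge D lam v ω)
  rw [dist_comm (θ v)] at htri
  simp only [dist_eq_norm] at htri
  rw [lowerGap]
  linarith

theorem norm_sub_le_upperGap (hα : 1 ≤ α) {u v : Fin U}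
    (hu : ‖ridge D lam u ω - θ u‖ ≤ confWidth D lam lamT δ u)
    (hv : ‖ridge D lam v ω - θ v‖ ≤ confWidth D lam lamT δ v) :
    ‖θ u - θ v‖ ≤ upperGap D lam lamT δ α u v ω := by
  have hα_le := le_mul_of_one_le_left
    (add_nonneg ((norm_nonneg _).trans hu) ((norm_nonneg _).trans hv)) hα
  have htri := dist_triangle4 (θ u) (ridge D lam u ω) (ridge D lam v ω) (θ v)
  rw [dist_comm (θ u) (ridge D lam u ω)] at htri
  simp only [dist_eq_norm] at htri
  rw [upperGap]
  linarith

/-- If `Γ(u, v) > 0`, then `α (CI_u + CI_v) < Γ̃(u, v) / 2`, so either `Γ̃(u, v) ≥ 2` or both widths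
are less than one and both confidence balls are valid. -/
theorem le_upperGap_of_lowerGap_pos (hα : 1 ≤ α)
    (hvalid : ∀ u, confWidth D lam lamT δ u ≤ 1 →
      ‖ridge D lam u ω - θ u‖ ≤ confWidth D lam lamT δ u)
    (hγ : γ ≤ 2) (hgap : ∀ u v, θ u ≠ θ v → γ ≤ ‖θ u - θ v‖) {u v : Fin U}
    (huv : 0 < lowerGap D lam lamT δ α u v ω) : γ ≤ upperGap D lam lamT δ α u v ω := by
  by_contra! hlt
  have hu0 := confWidth_nonneg D lam lamT δ u
  have hv0 := confWidth_nonneg D lam lamT δ v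
  have hsum : confWidth D lam lamT δ u + confWidth D lam lamT δ v < 1 := by
    have hα_le := le_mul_of_one_le_left (add_nonneg hu0 hv0) hα
    rw [lowerGap] at huv
    rw [upperGap] at hlt
    linarith
  have hu := hvalid u (by linarith)
  have hv := hvalid v (by linarith)
  have hne : θ u ≠ θ v := sub_ne_zero.1 (norm_pos_iff.1 (huv.trans_le
    (lowerGap_le_norm_sub hα hu hv)))
  exact hlt.not_ge ((hgap u v hne).trans (norm_sub_le_upperGap hα hu hv))

theorem le_gammaHatOver (hα : 1 ≤ α)
    (hvalid : ∀ u, confWidth D lam lamT δ u ≤ 1 →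
      ‖ridge D lam u ω - θ u‖ ≤ confWidth D lam lamT δ u)
    (hγ : γ ≤ 2) (hgap : ∀ u v, θ u ≠ θ v → γ ≤ ‖θ u - θ v‖) {u : Fin U}
    (hne : (certified D lam lamT δ α u ω).Nonempty) :
    γ ≤ gammaHatOver D lam lamT δ α u ω := by
  rw [gammaHatOver, dif_pos hne, Finset.le_inf'_iff]
  intro v hv
  rw [certified, Finset.mem_filter] at hv
  exact le_upperGap_of_lowerGap_pos hα hvalid hγ hgap hv.2.2

end Policy

end OffClusBand

end

open OffClusBand in
theorem mainTheorem8_general {Ω : Type*} {mΩ : MeasurableSpace Ω} (μ : Measure Ω)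
    [IsProbabilityMeasure μ] {U d S : ℕ} (θ : Fin U → Vec d) (hθ : ∀ u, ‖θ u‖ ≤ 1)
    (hne : ∃ u v, θ u ≠ θ v) (γ : ℝ) (hgap : ∀ u v, θ u ≠ θ v → γ ≤ ‖θ u - θ v‖)
    (ρ : Measure (Vec d)) (lamA : ℝ) (σ : ℝ≥0) (hρ : RegularActionLaw ρ lamA σ)
    (D : OfflineData Ω U d) (past : (u : Fin U) → Filtration ℕ mΩ)
    (hD : IsOffClusBand μ D θ ρ S past) (hN : ∀ u, 0 < D.N u)
    (α lam δ : ℝ) (hα : 1 ≤ α) (hlam : 0 < lam) (hδ : 0 < δ) :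
    1 - δ / 2 ≤ μ.real {ω | ∀ utest,
      (certified D lam (smoothedRegularity lamA σ S) δ α utest ω).Nonempty →
        γ ≤ gammaHatOver D lam (smoothedRegularity lamA σ S) δ α utest ω} := by
  set lamT := smoothedRegularity lamA σ S
  obtain ⟨u₁, u₂, hne⟩ := hne
  have hU : (0 : ℝ) < U := by exact_mod_cast Fin.pos u₁
  have hγ : γ ≤ 2 := by linarith [hgap u₁ u₂ hne, norm_sub_le (θ u₁) (θ u₂), hθ u₁, hθ u₂]
  set miss : Fin U → Set Ω := fun u =>
    {ω | confWidth D lam lamT δ u ≤ 1 ∧ confWidth D lam lamT δ u < ‖ridge D lam u ω - θ u‖}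
  have hmiss : μ.real (⋃ u, miss u) ≤ δ / 2 := by
    calc μ.real (⋃ u, miss u) ≤ ∑ u, μ.real (miss u) := measureReal_iUnion_fintype_le _
      _ ≤ ∑ _u : Fin U, δ / (2 * U) :=
          Finset.sum_le_sum fun u _ => hD.measureReal_confWidth_lt_le hρ hlam hδ (hN u) (hθ u)
      _ = δ / 2 := by
          rw [Finset.sum_const, Finset.card_univ, Fintype.card_fin, nsmul_eq_mul]
          field_simp
  have hcompl : 1 - μ.real (⋃ u, miss u) ≤ μ.real (⋃ u, miss u)ᶜ := by
    have hunion := measureReal_union_le (μ := μ) (⋃ u, miss u) (⋃ u, miss u)ᶜ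
    rw [Set.union_compl_self, probReal_univ] at hunion
    exact sub_le_iff_le_add'.2 hunion
  refine (sub_le_sub_left hmiss 1).trans (hcompl.trans (measureReal_mono fun ω hω utest h => ?_))
  refine le_gammaHatOver hα (fun u hCI => ?_) hγ hgap h
  exact not_lt.1 fun hlt => hω (Set.mem_iUnion.2 ⟨u, hCI, hlt⟩)

theorem mainTheorem8 {Ω : Type*} {mΩ : MeasurableSpace Ω} (μ : Measure Ω) [IsProbabilityMeasure μ]
    {U d J S : ℕ}
    -- users, clusters and preference vectors
    (θ : Fin U → OffClusBand.Vec d) (cluster : Fin U → Fin J)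
    (hcluster : ∀ u v, θ u = θ v ↔ cluster u = cluster v)
    (hθ : ∀ u, ‖θ u‖ ≤ 1)
    -- heterogeneity gap
    (hJ : ∃ u v, cluster u ≠ cluster v)
    (γ : ℝ) (hγ : 0 < γ) (hgap : ∀ u v, cluster u ≠ cluster v → γ ≤ ‖θ u - θ v‖)
    -- action regularity and the offline data
    (ρ : Measure (OffClusBand.Vec d)) (lamA : ℝ) (σ : ℝ≥0)
    (hρ : OffClusBand.RegularActionLaw ρ lamA σ)
    (D : OffClusBand.OfflineData Ω U d) (past : (u : Fin U) → Filtration ℕ mΩ)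
    (hD : OffClusBand.IsOffClusBand μ D θ ρ S past)
    (hN : ∀ u, 0 < D.N u)
    -- parameters of the algorithm
    (α lam δ : ℝ) (hα : 1 ≤ α) (hlam : 0 < lam) (hδ : 0 < δ)
    (utest : Fin U) :
    1 - 3 / 2 * δ ≤ μ.real {ω |
      (OffClusBand.certified D lam (OffClusBand.smoothedRegularity lamA σ S) δ α utest ω).Nonempty →
        γ ≤ OffClusBand.gammaHatOver D lam (OffClusBand.smoothedRegularity lamA σ S) δ α
          utest ω} := by
  simp only [ne_eq, ← hcluster] at hJ hgap
  exact (by linarith : 1 - 3 / 2 * δ ≤ 1 - δ / 2).trans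
    ((mainTheorem8_general μ θ hθ hJ γ hgap ρ lamA σ hρ D past hD hN α lam δ hα hlam hδ).trans
      (measureReal_mono fun _ hω => hω utest))
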